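/- **Setting.** Let $a<0<b$ and let $\mathcal Q^{\pm}\in L^\infty([a,b],\mathbb R^{2\times 2})$ be pointwise symmetric with $mI_2\le \mathcal Q^{\pm}(z)\le MI_2$ for a.e. $z\in[a,b]$, where $0<m\le M$. Let $X=L^2([a,b],\mathbb R^2)$. For $l\in(a,b)$ put $\mathcal Q_l=\mathbf 1_{[a,l)}\mathcal Q^-+\mathbf 1_{(l,b]}\mathcal Q^+$ and $$\langle x,y\rangle_{\mathcal Q_l}=\tfrac12\int_a^b y^\top(z)\mathcal Q_l(z)x(z)\,dz ,\qquad \|x\|_{\mathcal Q_l}^2=\langle x,x\rangle_{\mathcal Q_l}.$$ Let $D(\mathcal J_l)$ be the set of $y=(y_1,y_2)\in X$ with $y_1|_{(a,l)}\in H^1(a,l)$, $y_1|_{(l,b)}\in H^1(l,b)$ and $y_2\in H^1(a,b)$, and let $\mathcal J_l y=(-y_2',\,-y_1')$, where $y_1'$ is taken separately on $(a,l)$ and $(l,b)$. For $y\in D(\mathcal J_l)$ put, with $P_1=\begin{bmatrix}0&-1\\-1&0\end{bmatrix}$, $$f_\partial=\tfrac1{\sqrt2}P_1\,[y(b)-y(a)],\quad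 e_\partial=\tfrac1{\sqrt2}\,[y(b)+y(a)],\quad f_I=y_2(l),\quad e_I=-[y_1(l^+)-y_1(l^-)].$$ For $W_B\in\mathbb R^{2\times4}$ and $r\in\mathbb R$ define the operator $A_{\mathcal Q_l}x=\mathcal J_l(\mathcal Q_l x)$ on $$D(A_{\mathcal Q_l})=\Big\{x\in X:\ y:=\mathcal Q_lx\in D(\mathcal J_l),\ f_I=r\,e_I,\ W_B\begin{bmatrix}f_\partial\\ e_\partial\end{bmatrix}=0\Big\}.$$ A family $(A(t))_{t\in[0,\tau]}$ of generators of $C_0$-semigroups on a Banach space is called *Kato-stable* with stability constants $M_0\ge1$ and $\omega\in\mathbb R$ if $(\omega,\infty)\subset\rho(A(t))$ for all $t\in[0,\tau]$, and for all $k\in\mathbb N$, $0\le t_1\le\dots\le t_k\le\tau$ and $\lambda>\omega$, $$\|R(\lambda,A(t_k))\cdots R(\lambda,A(t_1))\|\le \frac{M_0}{(\lambda-\omega)^k}.$$ **Statement.** Let $0<\tau<\infty$ and let $l\colon[0,\tau]\to(a,b)$ be continuously differentiable. Assume: (A1) $\mathcal Q^{\pm}\in C^1([a,b],\mathbb R^{2\times2})$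 are diagonal with diagonal entries $q_{11}^\pm,q_{22}^\pm$, $\frac{q_{11}^+}{q_{11}^-}(0)=1$, and $\frac{q_{11}^+}{q_{11}^-}(z)=\frac{q_{22}^+}{q_{22}^-}(z)$ for all $z\in[a,b]$; (A2) $r=0$, $\operatorname{rank}W_B=2$ and $W_B\Sigma W_B^\top\ge0$, where $\Sigma=\begin{bmatrix}0&I_2\\I_2&0\end{bmatrix}$. Let $A(t)=A_{\mathcal Q_{l(t)}}$, regarded as an operator on $(X,\|\cdot\|_{\mathcal Q_0})$. Then there exists $\omega>0$ such that $$\langle A(t)x,x\rangle_{\mathcal Q_0}\le\omega\|x\|_{\mathcal Q_0}^2\qquad\text{for all }t\in[0,\tau],\ x\in D(A(t)),\tag{1}$$ and for every $\omega>0$ satisfying (1) the following hold. Each $A(t)$, $t\in[0,\tau]$, generates a quasi-contractive $C_0$-semigroup $(S_t(s))_{s\ge0}$ on $(X,\|\cdot\|_{\mathcal Q_0})$, with $\|S_t(s)\|\le e^{\omega s}$ for all $s\ge0$; and the family $(A(t))_{t\in[0,\tau]}$ is Kato-stable on $(X,\|\cdot\|_{\mathcal Q_0})$ with stability constants $M_0=1$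 and $\omega$. -/

import Mathlib

open MeasureTheory Set Filter Topology

/-! ### `C₀`-semigroups, generators, resolvents and Kato-stability -/

namespace Evolution

variable {E : Type*} [NormedAddCommGroup E] [NormedSpace ℝ E]

/-- `(T s)_{s ≥ 0}` is a `C₀`-semigroup (strongly continuous semigroup) on `E`;
values at negative `s` are irrelevant. -/
structure IsC0Semigroup (T : ℝ → E →L[ℝ] E) : Prop where
  map_zero : T 0 = ContinuousLinearMap.id ℝ E
  map_add : ∀ s t : ℝ, 0 ≤ s → 0 ≤ t → T (s + t) = (T s).comp (T t)
  tendsto_zero : ∀ x : E, Tendsto (fun h : ℝ => T h x) (𝓝[>] 0) (𝓝 x)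

/-- The (unbounded) operator `A` is the infinitesimal generator of `(T s)_{s ≥ 0}`: `x ∈ D(A)` and
`A x = y` if and only if `(T h x - x) / h → y` as `h ↓ 0`. -/
def IsGeneratorOf (A : E →ₗ.[ℝ] E) (T : ℝ → E →L[ℝ] E) : Prop :=
  ∀ x y : E, (x, y) ∈ A.graph ↔
    Tendsto (fun h : ℝ => h⁻¹ • (T h x - x)) (𝓝[>] 0) (𝓝 y)

/-- `A` is the infinitesimal generator of some `C₀`-semigroup. -/
def GeneratesC0Semigroup (A : E →ₗ.[ℝ] E) : Prop :=
  ∃ T : ℝ → E →L[ℝ] E, IsC0Semigroup T ∧ IsGeneratorOf A T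

/-- `A` generates a quasi-contractive `C₀`-semigroup with growth constant `ω`, that is,
`‖T s‖ ≤ exp (ω s)` for all `s ≥ 0`. -/
def GeneratesQuasiContractive (A : E →ₗ.[ℝ] E) (ω : ℝ) : Prop :=
  ∃ T : ℝ → E →L[ℝ] E, IsC0Semigroup T ∧ IsGeneratorOf A T ∧
    ∀ s : ℝ, 0 ≤ s → ‖T s‖ ≤ Real.exp (ω * s)

/-- `R` is a bounded two-sided inverse of `lam - A : D(A) → E`. -/
def IsResolventAt (A : E →ₗ.[ℝ] E) (lam : ℝ) (R : E →L[ℝ] E) : Prop :=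
  (∀ y : E, ∃ h : R y ∈ A.domain, lam • R y - A ⟨R y, h⟩ = y) ∧
    ∀ x : A.domain, R (lam • (x : E) - A x) = x

/-- The resolvent set `ρ(A)` (real spectral parameters). -/
def resolventSet (A : E →ₗ.[ℝ] E) : Set ℝ :=
  {lam | ∃ R : E →L[ℝ] E, IsResolventAt A lam R}

open Classical in
/-- The resolvent `R(lam, A) = (lam - A)⁻¹` for `lam ∈ ρ(A)` (and `0` otherwise). -/
noncomputable def resolvent (A : E →ₗ.[ℝ] E) (lam : ℝ) : E →L[ℝ] E :=
  if h : lam ∈ resolventSet A then h.choose else 0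

/-- Kato-stability with stability constants `M ≥ 1` and `ω` of a family `(A(t))_{t ∈ [0, τ]}` of
generators of `C₀`-semigroups. The product is time-ordered,
`R(lam, A(t_k)) ⋯ R(lam, A(t_1))` for `t_1 ≤ ⋯ ≤ t_k`. -/
structure IsKatoStableWith {τ : ℝ} (A : Icc (0 : ℝ) τ → E →ₗ.[ℝ] E) (M ω : ℝ) : Prop where
  one_le : 1 ≤ M
  generates : ∀ t, GeneratesC0Semigroup (A t)
  subset_resolventSet : ∀ t, Ioi ω ⊆ resolventSet (A t)
  norm_prod_le : ∀ (k : ℕ) (t : Fin k → Icc (0 : ℝ) τ), Monotone t → ∀ lam : ℝ, ω < lam →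
    ‖((List.ofFn fun j => resolvent (A (t j)) lam).reverse).prod‖ ≤ M / (lam - ω) ^ k

end Evolution

/-! ### The Sobolev space `H¹` of an interval -/

namespace Interval

/-- `f` belongs to `H¹(α, β)`, with absolutely continuous representative `u` on `[α, β]` and weak
derivative `v ∈ L²(α, β)`: `f = u` almost everywhere and `u z = u α + ∫_α^z v`. -/
structure IsH1Rep (α β : ℝ) (f u v : ℝ → ℝ) : Prop where
  ae_eq : f =ᵐ[volume.restrict (Icc α β)] u
  memLp : MemLp v 2 (volume.restrict (Icc α β))
  eq_integral : ∀ z ∈ Icc α β, u z = u α + ∫ s in α..z, v s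

/-- (The class of) `f` belongs to `H¹((α, β), ℝ)`. -/
def MemH1 (α β : ℝ) (f : ℝ → ℝ) : Prop := ∃ u v : ℝ → ℝ, IsH1Rep α β f u v

open Classical in
/-- The continuous representative on `[α, β]` of `f ∈ H¹(α, β)`. It gives the boundary values
`f(α⁺)` and `f(β⁻)`. -/
noncomputable def contRep (α β : ℝ) (f : ℝ → ℝ) : ℝ → ℝ :=
  if h : MemH1 α β f then h.choose else 0

open Classical in
/-- The weak derivative on `(α, β)` of `f ∈ H¹(α, β)`. -/
noncomputable def weakDeriv (α β : ℝ) (f : ℝ → ℝ) : ℝ → ℝ :=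
  if h : MemH1 α β f then h.choose_spec.choose else 0

variable {α β : ℝ} {f g h u u' v v' : ℝ → ℝ}

theorem MemH1.isH1Rep (hf : MemH1 α β f) :
    IsH1Rep α β f (contRep α β f) (weakDeriv α β f) := by
  simp only [contRep, weakDeriv, hf, dif_pos]
  exact hf.choose_spec.choose_spec

theorem IsH1Rep.integrableOn (hf : IsH1Rep α β f u v) : IntegrableOn v (Icc α β) :=
  hf.memLp.integrable (by norm_num)

theorem IsH1Rep.intervalIntegrable (hf : IsH1Rep α β f u v) {z : ℝ} (hz : z ∈ Icc α β) :
    IntervalIntegrable v volume α z := by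
  rw [intervalIntegrable_iff_integrableOn_Icc_of_le hz.1]
  exact hf.integrableOn.mono_set (Icc_subset_Icc_right hz.2)

theorem IsH1Rep.continuousOn (hf : IsH1Rep α β f u v) : ContinuousOn u (Icc α β) := by
  have h1 : ContinuousOn (fun z => u α + ∫ s in α..z, v s) (Icc α β) := by
    refine continuousOn_const.add ?_
    rcases le_or_gt α β with hab | hab
    · have := intervalIntegral.continuousOn_primitive_interval (μ := volume) (f := v)
        (a := α) (b := β) (by rw [uIcc_of_le hab]; exact hf.integrableOn)
      rwa [uIcc_of_le hab] at this
    · rw [Icc_eq_empty (not_le.2 hab)]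
      exact continuousOn_empty _
  exact h1.congr hf.eq_integral

theorem IsH1Rep.comb (hf : IsH1Rep α β f u v) (hg : IsH1Rep α β g u' v') (c d : ℝ)
    (hh : h =ᵐ[volume.restrict (Icc α β)] fun z => c * f z + d * g z) :
    IsH1Rep α β h (fun z => c * u z + d * u' z) (fun z => c * v z + d * v' z) where
  ae_eq := by
    filter_upwards [hh, hf.ae_eq, hg.ae_eq] with z h1 h2 h3
    rw [h1, h2, h3]
  memLp := (hf.memLp.const_mul c).add (hg.memLp.const_mul d)
  eq_integral := by
    intro z hz
    have e1 := hf.eq_integral z hz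
    have e2 := hg.eq_integral z hz
    rw [intervalIntegral.integral_add ((hf.intervalIntegrable hz).const_mul c)
      ((hg.intervalIntegrable hz).const_mul d), intervalIntegral.integral_const_mul,
      intervalIntegral.integral_const_mul]
    simp only [e1, e2]
    ring

theorem IsH1Rep.eqOn (hf : IsH1Rep α β f u v) (hf' : IsH1Rep α β f u' v') (hab : α < β) :
    EqOn u u' (Icc α β) :=
  Measure.eqOn_Icc_of_ae_eq volume hab.ne (hf.ae_eq.symm.trans hf'.ae_eq)
    hf.continuousOn hf'.continuousOn

theorem IsH1Rep.deriv_ae_eq (hf : IsH1Rep α β f u v) (hf' : IsH1Rep α β f u' v') :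
    v =ᵐ[volume.restrict (Icc α β)] v' := by
  rcases lt_or_ge α β with hab | hab
  · have key : ∀ {u v : ℝ → ℝ}, IsH1Rep α β f u v →
        ∀ᵐ z, z ∈ Ioo α β → HasDerivAt u (v z) z := by
      intro u v hf
      have hi := hf.intervalIntegrable (right_mem_Icc.2 hab.le)
      filter_upwards [hi.ae_hasDerivAt_integral] with z hz hzm
      have hzI : z ∈ uIcc α β := by rw [uIcc_of_le hab.le]; exact Ioo_subset_Icc_self hzm
      have h1 := (hz hzI α left_mem_uIcc).const_add (u α)
      refine h1.congr_of_eventuallyEq ?_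
      filter_upwards [Ioo_mem_nhds hzm.1 hzm.2] with y hy
      exact hf.eq_integral y (Ioo_subset_Icc_self hy)
    have heq := hf.eqOn hf' hab
    rw [← Measure.restrict_congr_set (Ioo_ae_eq_Icc (μ := volume) (a := α) (b := β)), EventuallyEq,
      ae_restrict_iff' measurableSet_Ioo]
    filter_upwards [key hf, key hf'] with z h1 h2 hz
    refine (h1 hz).unique ((h2 hz).congr_of_eventuallyEq ?_)
    filter_upwards [Ioo_mem_nhds hz.1 hz.2] with y hy
    exact heq (Ioo_subset_Icc_self hy)
  · have : volume.restrict (Icc α β) = 0 := by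
      rw [Measure.restrict_eq_zero, Real.volume_Icc]
      simpa using hab
    rw [this]
    simp [EventuallyEq]

theorem isH1Rep_zero (hf : f =ᵐ[volume.restrict (Icc α β)] fun _ => 0) :
    IsH1Rep α β f (fun _ => 0) (fun _ => 0) where
  ae_eq := hf
  memLp := MemLp.zero
  eq_integral := by intro z _; simp

theorem MemH1.comb (hf : MemH1 α β f) (hg : MemH1 α β g) (c d : ℝ)
    (hh : h =ᵐ[volume.restrict (Icc α β)] fun z => c * f z + d * g z) : MemH1 α β h :=
  ⟨_, _, hf.isH1Rep.comb hg.isH1Rep c d hh⟩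

theorem contRep_comb (hf : MemH1 α β f) (hg : MemH1 α β g) (c d : ℝ)
    (hh : h =ᵐ[volume.restrict (Icc α β)] fun z => c * f z + d * g z) (hab : α < β) {z : ℝ}
    (hz : z ∈ Icc α β) :
    contRep α β h z = c * contRep α β f z + d * contRep α β g z :=
  (hf.comb hg c d hh).isH1Rep.eqOn (hf.isH1Rep.comb hg.isH1Rep c d hh) hab hz

theorem weakDeriv_comb (hf : MemH1 α β f) (hg : MemH1 α β g) (c d : ℝ)
    (hh : h =ᵐ[volume.restrict (Icc α β)] fun z => c * f z + d * g z) :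
    weakDeriv α β h =ᵐ[volume.restrict (Icc α β)]
      fun z => c * weakDeriv α β f z + d * weakDeriv α β g z :=
  (hf.comb hg c d hh).isH1Rep.deriv_ae_eq (hf.isH1Rep.comb hg.isH1Rep c d hh)

end Interval

/-! ### The port-Hamiltonian system with an interface -/

/-- Data of two coupled systems of conservation laws on `[a, b]`, `a < 0 < b`: coefficient matrices
`Q⁻, Q⁺ ∈ L^∞([a, b], ℝ^{2×2})`, pointwise symmetric with `m I ≤ Q^±(z) ≤ M I` for almost every
`z ∈ [a, b]`, where `0 < m ≤ M`. (`PosSemidef` includes symmetry.) -/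
structure InterfaceSystem where
  a : ℝ
  b : ℝ
  a_neg : a < 0
  b_pos : 0 < b
  Qm : ℝ → Matrix (Fin 2) (Fin 2) ℝ
  Qp : ℝ → Matrix (Fin 2) (Fin 2) ℝ
  m : ℝ
  M : ℝ
  m_pos : 0 < m
  m_le_M : m ≤ M
  aestronglyMeasurable_Qm : ∀ i j,
    AEStronglyMeasurable (fun z => Qm z i j) (volume.restrict (Icc a b))
  aestronglyMeasurable_Qp : ∀ i j,
    AEStronglyMeasurable (fun z => Qp z i j) (volume.restrict (Icc a b))
  bounds_Qm : ∀ᵐ z ∂(volume.restrict (Icc a b)),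
    (Qm z - m • (1 : Matrix (Fin 2) (Fin 2) ℝ)).PosSemidef ∧
      (M • (1 : Matrix (Fin 2) (Fin 2) ℝ) - Qm z).PosSemidef
  bounds_Qp : ∀ᵐ z ∂(volume.restrict (Icc a b)),
    (Qp z - m • (1 : Matrix (Fin 2) (Fin 2) ℝ)).PosSemidef ∧
      (M • (1 : Matrix (Fin 2) (Fin 2) ℝ) - Qp z).PosSemidef

namespace InterfaceSystem

/-- Color function `c_l⁻`, the indicator of `[a, l)` on `[a, b]`. -/
noncomputable def colorMinus (l z : ℝ) : ℝ := if z < l then 1 else 0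

/-- Color function `c_l⁺`, the indicator of `(l, b]` on `[a, b]`. -/
noncomputable def colorPlus (l z : ℝ) : ℝ := if l < z then 1 else 0

variable (S : InterfaceSystem)

/-- Lebesgue measure on `[a, b]`. -/
noncomputable abbrev μ : Measure ℝ := volume.restrict (Icc S.a S.b)

/-- `L²([a, b], ℝ)`. -/
abbrev L2 : Type := Lp ℝ 2 S.μ

/-- The state space `X = L²([a, b], ℝ²)` with its `L²` inner product. -/
abbrev X : Type := Lp (EuclideanSpace ℝ (Fin 2)) 2 S.μ

/-- The matrix function `Q_l = c_l⁻ Q⁻ + c_l⁺ Q⁺`. -/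
noncomputable def Q (l z : ℝ) : Matrix (Fin 2) (Fin 2) ℝ :=
  colorMinus l z • S.Qm z + colorPlus l z • S.Qp z

theorem bounds_Q (l : ℝ) : ∀ᵐ z ∂S.μ,
    (S.Q l z - S.m • (1 : Matrix (Fin 2) (Fin 2) ℝ)).PosSemidef ∧
      (S.M • (1 : Matrix (Fin 2) (Fin 2) ℝ) - S.Q l z).PosSemidef := by
  have hne : ∀ᵐ z ∂S.μ, z ≠ l := by
    refine ae_restrict_of_ae ?_
    simp [ae_iff, measure_singleton]
  filter_upwards [S.bounds_Qm, S.bounds_Qp, hne] with z h1 h2 h3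
  rcases lt_or_gt_of_ne h3 with h | h
  · simpa [Q, colorMinus, colorPlus, h, h.not_gt] using h1
  · simpa [Q, colorMinus, colorPlus, h, h.not_gt] using h2

theorem measurable_colorMinus (l : ℝ) : Measurable (colorMinus l) :=
  Measurable.ite measurableSet_Iio measurable_const measurable_const

theorem measurable_colorPlus (l : ℝ) : Measurable (colorPlus l) :=
  Measurable.ite measurableSet_Ioi measurable_const measurable_const

theorem quad_bounds {A : Matrix (Fin 2) (Fin 2) ℝ} {m M : ℝ}
    (h1 : (A - m • (1 : Matrix (Fin 2) (Fin 2) ℝ)).PosSemidef)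
    (h2 : (M • (1 : Matrix (Fin 2) (Fin 2) ℝ) - A).PosSemidef) :
    A 0 1 = A 1 0 ∧ ∀ p q : ℝ,
      m * (p ^ 2 + q ^ 2) ≤ A 0 0 * p ^ 2 + 2 * A 0 1 * (p * q) + A 1 1 * q ^ 2 ∧
      A 0 0 * p ^ 2 + 2 * A 0 1 * (p * q) + A 1 1 * q ^ 2 ≤ M * (p ^ 2 + q ^ 2) := by
  have hs : A 0 1 = A 1 0 := by
    have := h1.1.apply 0 1
    simpa using this.symm
  refine ⟨hs, fun p q => ?_⟩
  have e1 := h1.dotProduct_mulVec_nonneg ![p, q]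
  have e2 := h2.dotProduct_mulVec_nonneg ![p, q]
  simp [Matrix.mulVec, dotProduct, Fin.sum_univ_two, Matrix.sub_apply, Matrix.smul_apply,
    Matrix.one_apply] at e1 e2
  rw [← hs] at e1 e2
  constructor <;> nlinarith

theorem abs_Q_le (l : ℝ) : ∀ᵐ z ∂S.μ, ∀ i j, ‖S.Q l z i j‖ ≤ S.M := by
  filter_upwards [S.bounds_Q l] with z hz
  obtain ⟨hs, hq⟩ := quad_bounds hz.1 hz.2
  have hm := S.m_pos
  have hmM := S.m_le_M
  have q1 := hq 1 0
  have q2 := hq 0 1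
  have q3 := hq 1 1
  have q4 := hq 1 (-1)
  intro i j
  rw [Real.norm_eq_abs, abs_le]
  fin_cases i <;> fin_cases j <;> simp <;> constructor <;> linarith

theorem aestronglyMeasurable_Q (l : ℝ) (i j : Fin 2) :
    AEStronglyMeasurable (fun z => S.Q l z i j) S.μ :=
  ((measurable_colorMinus l).aestronglyMeasurable.mul (S.aestronglyMeasurable_Qm i j)).add
    ((measurable_colorPlus l).aestronglyMeasurable.mul (S.aestronglyMeasurable_Qp i j))

theorem memLp_Q_mulVec (l : ℝ) (x : S.X) :
    MemLp (fun z => WithLp.toLp 2 (Matrix.mulVec (S.Q l z) (x z).ofLp)) 2 S.μ := by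
  refine MemLp.of_eval_piLp fun i => ?_
  simp only [Matrix.mulVec, dotProduct]
  refine memLp_finsetSum _ fun j _ => ?_
  have hx : MemLp (fun z => (x z).ofLp j) 2 S.μ := (Lp.memLp x).eval_piLp j
  refine hx.of_le_mul (c := S.M) ((S.aestronglyMeasurable_Q l i j).mul hx.1) ?_
  filter_upwards [S.abs_Q_le l] with z hz
  rw [norm_mul]
  exact mul_le_mul_of_nonneg_right (hz i j) (norm_nonneg _)

/-- The matrix multiplication operator `Q_l` on `X`, `(Q_l x)(z) = Q_l(z) x(z)`. -/
noncomputable def mulQ (l : ℝ) : S.X →ₗ[ℝ] S.X where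
  toFun x := (S.memLp_Q_mulVec l x).toLp _
  map_add' x y := by
    refine Lp.ext ?_
    filter_upwards [(S.memLp_Q_mulVec l (x + y)).coeFn_toLp,
      (S.memLp_Q_mulVec l x).coeFn_toLp, (S.memLp_Q_mulVec l y).coeFn_toLp,
      Lp.coeFn_add x y, Lp.coeFn_add ((S.memLp_Q_mulVec l x).toLp _)
        ((S.memLp_Q_mulVec l y).toLp _)] with z h1 h2 h3 h4 h5
    rw [h1, h5, Pi.add_apply, h2, h3, h4, Pi.add_apply, WithLp.ofLp_add, Matrix.mulVec_add,
      WithLp.toLp_add]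
  map_smul' c x := by
    refine Lp.ext ?_
    filter_upwards [(S.memLp_Q_mulVec l (c • x)).coeFn_toLp,
      (S.memLp_Q_mulVec l x).coeFn_toLp, Lp.coeFn_smul c x,
      Lp.coeFn_smul c ((S.memLp_Q_mulVec l x).toLp _)] with z h1 h2 h3 h4
    rw [h1, RingHom.id_apply, h4, Pi.smul_apply, h2, h3, Pi.smul_apply, WithLp.ofLp_smul,
      Matrix.mulVec_smul, WithLp.toLp_smul]

theorem coeFn_mulQ (l : ℝ) (x : S.X) :
    S.mulQ l x =ᵐ[S.μ] fun z => WithLp.toLp 2 (Matrix.mulVec (S.Q l z) (x z).ofLp) :=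
  (S.memLp_Q_mulVec l x).coeFn_toLp

theorem inner_mulQ_comm (l : ℝ) (x y : S.X) :
    inner ℝ (S.mulQ l y) x = inner ℝ (S.mulQ l x) y := by
  rw [L2.inner_def, L2.inner_def]
  refine integral_congr_ae ?_
  filter_upwards [S.coeFn_mulQ l x, S.coeFn_mulQ l y, S.bounds_Q l] with z h1 h2 h3
  have hs := (quad_bounds h3.1 h3.2).1
  rw [h1, h2]
  simp only [PiLp.inner_apply, Fin.sum_univ_two, Matrix.mulVec, dotProduct]
  simp only [RCLike.inner_apply, conj_trivial]
  rw [hs]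
  ring

theorem le_inner_mulQ (l : ℝ) (x : S.X) : S.m * ‖x‖ ^ 2 ≤ inner ℝ (S.mulQ l x) x := by
  rw [← real_inner_self_eq_norm_sq, L2.inner_def, L2.inner_def, ← integral_const_mul]
  refine integral_mono_ae ((L2.integrable_inner x x).const_mul _) (L2.integrable_inner _ _) ?_
  filter_upwards [S.coeFn_mulQ l x, S.bounds_Q l] with z h1 h3
  obtain ⟨hs, hq⟩ := quad_bounds h3.1 h3.2
  have h := (hq ((x z).ofLp 0) ((x z).ofLp 1)).1
  rw [h1]
  simp only [PiLp.inner_apply, Fin.sum_univ_two, Matrix.mulVec, dotProduct]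
  simp only [RCLike.inner_apply, conj_trivial]
  rw [← hs]
  nlinarith [h]

/-! #### The energy space `(X, ‖·‖_{Q_l})` -/

/-- The energy space `(X, ‖·‖_{Q_l})`: the vector space `X` with the inner product
`⟨x, y⟩_{Q_l} = ½ ⟨Q_l x, y⟩_{L²} = ½ ∫_a^b y(z)ᵀ Q_l(z) x(z) dz`. -/
def EnergySpace (S : InterfaceSystem) (_l : ℝ) : Type := S.X

noncomputable instance (l : ℝ) : AddCommGroup (S.EnergySpace l) :=
  inferInstanceAs (AddCommGroup S.X)

noncomputable instance (l : ℝ) : Module ℝ (S.EnergySpace l) :=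
  inferInstanceAs (Module ℝ S.X)

/-- The identity map from the energy space to `X`. -/
noncomputable def toX (l : ℝ) : S.EnergySpace l ≃ₗ[ℝ] S.X := LinearEquiv.refl ℝ S.X

/-- The inner product `⟨·, ·⟩_{Q_l}`. -/
@[reducible]
noncomputable def energyCore (l : ℝ) : InnerProductSpace.Core ℝ (S.EnergySpace l) where
  inner x y := (1 / 2 : ℝ) * inner ℝ (S.mulQ l (S.toX l x)) (S.toX l y)
  conj_inner_symm x y := by
    rw [conj_trivial, inner_mulQ_comm]
  re_inner_nonneg x := by
    have h := S.le_inner_mulQ l (S.toX l x)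
    have := mul_nonneg S.m_pos.le (sq_nonneg ‖S.toX l x‖)
    simp only [RCLike.re_to_real]
    linarith
  add_left x y z := by
    rw [map_add, map_add, inner_add_left, mul_add]
  smul_left x y r := by
    rw [map_smul, map_smul, real_inner_smul_left, conj_trivial]
    ring
  definite x hx := by
    have h := S.le_inner_mulQ l (S.toX l x)
    have h2 : S.m * ‖S.toX l x‖ ^ 2 ≤ 0 := by linarith
    have h3 : ‖S.toX l x‖ ^ 2 ≤ 0 := by
      by_contra hc
      have := mul_pos S.m_pos (not_le.1 hc)
      linarith
    have h4 : ‖S.toX l x‖ = 0 := by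
      have := sq_nonneg ‖S.toX l x‖
      exact pow_eq_zero_iff (two_ne_zero) |>.1 (le_antisymm h3 this)
    exact (S.toX l).map_eq_zero_iff.1 (norm_eq_zero.1 h4)

noncomputable instance (l : ℝ) : NormedAddCommGroup (S.EnergySpace l) :=
  (S.energyCore l).toNormedAddCommGroup

noncomputable instance (l : ℝ) : InnerProductSpace ℝ (S.EnergySpace l) :=
  InnerProductSpace.ofCore (S.energyCore l).toCore

theorem energy_inner_def (l : ℝ) (x y : S.EnergySpace l) :
    inner ℝ x y = (1 / 2 : ℝ) * inner ℝ (S.mulQ l (S.toX l x)) (S.toX l y) := rfl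

/-! #### The operators `d_l`, `d_l^*`, `J_l` -/

/-- An interface position `l ∈ (a, b)`. -/
abbrev Position : Type := Ioo S.a S.b

/-- The interface position `0 ∈ (a, b)`. -/
def origin : S.Position := ⟨0, S.a_neg, S.b_pos⟩

theorem ae_left (l : S.Position) {p : ℝ → Prop} (h : ∀ᵐ z ∂S.μ, p z) :
    ∀ᵐ z ∂(volume.restrict (Icc S.a (l : ℝ))), p z :=
  ae_restrict_of_ae_restrict_of_subset (Icc_subset_Icc_right l.2.2.le) h

theorem ae_right (l : S.Position) {p : ℝ → Prop} (h : ∀ᵐ z ∂S.μ, p z) :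
    ∀ᵐ z ∂(volume.restrict (Icc (l : ℝ) S.b)), p z :=
  ae_restrict_of_ae_restrict_of_subset (Icc_subset_Icc_left l.2.1.le) h

open Interval

theorem coeFn_comb (f g : S.L2) (c d : ℝ) :
    ⇑(c • f + d • g) =ᵐ[S.μ] fun z => c * f z + d * g z := by
  filter_upwards [Lp.coeFn_add (c • f) (d • g), Lp.coeFn_smul c f, Lp.coeFn_smul d g]
    with z h1 h2 h3
  rw [h1, Pi.add_apply, h2, h3]
  rfl

/-- A set of vectors containing `0` and closed under linear combinations, as a submodule. -/
def combSubmodule {V : Type*} [AddCommGroup V] [Module ℝ V] (p : V → Prop) (h0 : p 0)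
    (hc : ∀ x y : V, p x → p y → ∀ c d : ℝ, p (c • x + d • y)) : Submodule ℝ V where
  carrier := {x | p x}
  zero_mem' := h0
  add_mem' := by
    intro x y hx hy
    simpa using hc x y hx hy 1 1
  smul_mem' := by
    intro c x hx
    simpa using hc x x hx hx c 0

/-- A map respecting linear combinations, as a linear map. -/
def combLinearMap {V W : Type*} [AddCommGroup V] [Module ℝ V] [AddCommGroup W] [Module ℝ W]
    (f : V → W) (hc : ∀ (x y : V) (c d : ℝ), f (c • x + d • y) = c • f x + d • f y) :
    V →ₗ[ℝ] W where
  toFun := f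
  map_add' x y := by simpa using hc x y 1 1
  map_smul' c x := by simpa using hc x x c 0

/-- The domain `D(d_l) = H¹([a, b], ℝ)`. -/
noncomputable def dDomain : Submodule ℝ S.L2 :=
  combSubmodule (fun f => MemH1 S.a S.b f)
    ⟨_, _, isH1Rep_zero (Lp.coeFn_zero ℝ 2 S.μ)⟩
    (fun f g hf hg c d => hf.comb hg c d (S.coeFn_comb f g c d))

/-- The domain `D(d_l^*)` of all `y ∈ L²([a, b], ℝ)` that are `H¹` on `(a, l)` and on `(l, b)`. -/
noncomputable def dStarDomain (l : S.Position) : Submodule ℝ S.L2 :=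
  combSubmodule (fun f => MemH1 S.a l f ∧ MemH1 l S.b f)
    ⟨⟨_, _, isH1Rep_zero (S.ae_left l (Lp.coeFn_zero ℝ 2 S.μ))⟩,
      ⟨_, _, isH1Rep_zero (S.ae_right l (Lp.coeFn_zero ℝ 2 S.μ))⟩⟩
    (fun f g hf hg c d =>
      ⟨hf.1.comb hg.1 c d (S.ae_left l (S.coeFn_comb f g c d)),
        hf.2.comb hg.2 c d (S.ae_right l (S.coeFn_comb f g c d))⟩)

theorem memLp_dStar (l : S.Position) {f : ℝ → ℝ} (h : MemH1 S.a l f ∧ MemH1 l S.b f) :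
    MemLp (fun z => colorMinus l z * weakDeriv S.a l f z + colorPlus l z * weakDeriv l S.b f z)
      2 S.μ := by
  have e1 : (fun z => colorMinus l z * weakDeriv S.a l f z) =
      (Iio (l : ℝ)).indicator (weakDeriv S.a l f) := by
    funext z
    by_cases hz : z < l <;> simp [colorMinus, hz]
  have e2 : (fun z => colorPlus l z * weakDeriv l S.b f z) =
      (Ioi (l : ℝ)).indicator (weakDeriv l S.b f) := by
    funext z
    by_cases hz : l < z <;> simp [colorPlus, hz]
  have hsub1 : Iio (l : ℝ) ∩ Icc S.a S.b ⊆ Icc S.a (l : ℝ) :=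
    fun z hz => ⟨hz.2.1, le_of_lt hz.1⟩
  have h1 : MemLp (fun z => colorMinus l z * weakDeriv S.a l f z) 2 S.μ := by
    rw [e1, memLp_indicator_iff_restrict measurableSet_Iio,
      Measure.restrict_restrict measurableSet_Iio]
    exact h.1.isH1Rep.memLp.mono_measure (Measure.restrict_mono hsub1 le_rfl)
  have hsub2 : Ioi (l : ℝ) ∩ Icc S.a S.b ⊆ Icc (l : ℝ) S.b :=
    fun z hz => ⟨le_of_lt hz.1, hz.2.2⟩
  have h2 : MemLp (fun z => colorPlus l z * weakDeriv l S.b f z) 2 S.μ := by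
    rw [e2, memLp_indicator_iff_restrict measurableSet_Ioi,
      Measure.restrict_restrict measurableSet_Ioi]
    exact h.2.isH1Rep.memLp.mono_measure (Measure.restrict_mono hsub2 le_rfl)
  exact h1.add h2

/-- The operator `d_l` with domain `H¹([a, b], ℝ)`. Since the jump contributions of the color
functions at `l` cancel, it acts as `d_l x = -x'`. -/
noncomputable def dOp : S.L2 →ₗ.[ℝ] S.L2 where
  domain := S.dDomain
  toFun := combLinearMap
    (fun f => -(MemH1.isH1Rep f.2).memLp.toLp (weakDeriv S.a S.b f))
    (by
      intro f g c d
      rw [smul_neg, smul_neg, ← neg_add, neg_inj]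
      refine Lp.ext ?_
      have hw := weakDeriv_comb f.2 g.2 c d (S.coeFn_comb f g c d)
      refine ((MemLp.coeFn_toLp _).trans hw).trans ?_
      filter_upwards [S.coeFn_comb ((MemH1.isH1Rep f.2).memLp.toLp (weakDeriv S.a S.b f))
          ((MemH1.isH1Rep g.2).memLp.toLp (weakDeriv S.a S.b g)) c d,
        (MemH1.isH1Rep f.2).memLp.coeFn_toLp, (MemH1.isH1Rep g.2).memLp.coeFn_toLp]
        with z h1 h2 h3
      rw [h1, h2, h3])

/-- The formal adjoint `d_l^*`, acting piecewise as
`d_l^* y = c_l⁻ (y|_{(a, l)})' + c_l⁺ (y|_{(l, b)})'`. -/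
noncomputable def dStarOp (l : S.Position) : S.L2 →ₗ.[ℝ] S.L2 where
  domain := S.dStarDomain l
  toFun := combLinearMap (fun f => (S.memLp_dStar l f.2).toLp _)
    (by
      intro f g c d
      refine Lp.ext ?_
      have hw1 := weakDeriv_comb f.2.1 g.2.1 c d (S.ae_left l (S.coeFn_comb f g c d))
      have hw2 := weakDeriv_comb f.2.2 g.2.2 c d (S.ae_right l (S.coeFn_comb f g c d))
      rw [EventuallyEq, ae_restrict_iff' measurableSet_Icc] at hw1 hw2
      filter_upwards [(S.memLp_dStar l (c • f + d • g).2).coeFn_toLp,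
        S.coeFn_comb ((S.memLp_dStar l f.2).toLp _) ((S.memLp_dStar l g.2).toLp _) c d,
        (S.memLp_dStar l f.2).coeFn_toLp, (S.memLp_dStar l g.2).coeFn_toLp,
        ae_restrict_of_ae hw1, ae_restrict_of_ae hw2, ae_restrict_mem measurableSet_Icc]
        with z h0 h1 h2 h3 h4 h5 hz
      rw [h0, h1, h2, h3]
      rcases lt_trichotomy z l with h | h | h
      · have := h4 ⟨hz.1, h.le⟩
        simp only [colorMinus, colorPlus, h, h.not_gt, if_true, if_false, zero_mul, one_mul,
          add_zero]
        exact this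
      · simp [colorMinus, colorPlus, h]
      · have := h5 ⟨h.le, hz.2⟩
        simp only [colorMinus, colorPlus, h, h.not_gt, if_true, if_false, zero_mul, one_mul,
          zero_add]
        exact this)

/-- The component `x ↦ x_i`, `X → L²([a, b], ℝ)`; the indices `0, 1` stand for `1, 2`. -/
noncomputable def comp (i : Fin 2) : S.X →L[ℝ] S.L2 :=
  (EuclideanSpace.proj i : EuclideanSpace ℝ (Fin 2) →L[ℝ] ℝ).compLpL 2 S.μ

/-- The inclusion `L²([a, b], ℝ) → X` of the `i`-th component. -/
noncomputable def incl (i : Fin 2) : S.L2 →L[ℝ] S.X :=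
  (ContinuousLinearMap.toSpanSingleton ℝ (EuclideanSpace.single i (1 : ℝ))).compLpL 2 S.μ

/-- The operator `J_l x = (d_l x₂, -d_l^* x₁)` with domain `D(J_l) = D(d_l^*) × D(d_l)`. -/
noncomputable def J (l : S.Position) : S.X →ₗ.[ℝ] S.X where
  domain := (S.dStarOp l).domain.comap (S.comp 0).toLinearMap ⊓
    S.dOp.domain.comap (S.comp 1).toLinearMap
  toFun := combLinearMap
    (fun x => S.incl 0 (S.dOp ⟨S.comp 1 x, x.2.2⟩) - S.incl 1 (S.dStarOp l ⟨S.comp 0 x, x.2.1⟩))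
    (by
      intro x y c d
      have e1 : (⟨S.comp 1 (c • x + d • y : S.X), (c • x + d • y).2.2⟩ : S.dOp.domain) =
          c • ⟨S.comp 1 x, x.2.2⟩ + d • ⟨S.comp 1 y, y.2.2⟩ := by
        ext1
        simp
      have e2 : (⟨S.comp 0 (c • x + d • y : S.X), (c • x + d • y).2.1⟩ : (S.dStarOp l).domain) =
          c • ⟨S.comp 0 x, x.2.1⟩ + d • ⟨S.comp 0 y, y.2.1⟩ := by
        ext1
        simp
      change S.incl 0 (S.dOp ⟨S.comp 1 (c • x + d • y : S.X), (c • x + d • y).2.2⟩) -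
        S.incl 1 (S.dStarOp l ⟨S.comp 0 (c • x + d • y : S.X), (c • x + d • y).2.1⟩) = _
      rw [e1, e2]
      simp only [LinearPMap.map_add, LinearPMap.map_smul, map_add, map_smul, smul_sub]
      abel)

/-! #### Boundary and interface port variables

Here `y` stands for `Q_l x ∈ D(J_l)`. -/

/-- The boundary value `y(a) = (y₁(a), y₂(a))`. -/
noncomputable def valueA (l : S.Position) (y : S.X) : Fin 2 → ℝ :=
  ![contRep S.a l (S.comp 0 y) S.a, contRep S.a S.b (S.comp 1 y) S.a]

/-- The boundary value `y(b) = (y₁(b), y₂(b))`. -/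
noncomputable def valueB (l : S.Position) (y : S.X) : Fin 2 → ℝ :=
  ![contRep l S.b (S.comp 0 y) S.b, contRep S.a S.b (S.comp 1 y) S.b]

/-- The matrix `P₁`. -/
def P₁ : Matrix (Fin 2) (Fin 2) ℝ := !![0, -1; -1, 0]

/-- The boundary flow `f_∂ = (1/√2) P₁ (y(b) - y(a))`. -/
noncomputable def boundaryFlow (l : S.Position) (y : S.X) : Fin 2 → ℝ :=
  (1 / √2) • Matrix.mulVec P₁ (S.valueB l y - S.valueA l y)

/-- The boundary effort `e_∂ = (1/√2) (y(b) + y(a))`. -/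
noncomputable def boundaryEffort (l : S.Position) (y : S.X) : Fin 2 → ℝ :=
  (1 / √2) • (S.valueB l y + S.valueA l y)

/-- The interface flow `f_I = y₂(l⁺) = y₂(l⁻)` (`y₂` is continuous on `[a, b]`). -/
noncomputable def interfaceFlow (l : S.Position) (y : S.X) : ℝ :=
  contRep S.a S.b (S.comp 1 y) l

/-- The interface effort `e_I = -(y₁(l⁺) - y₁(l⁻))`. -/
noncomputable def interfaceEffort (l : S.Position) (y : S.X) : ℝ :=
  -(contRep l S.b (S.comp 0 y) l - contRep S.a l (S.comp 0 y) l)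

theorem trace_comb (l : S.Position) {x y : S.X} (hx : x ∈ (S.J l).domain)
    (hy : y ∈ (S.J l).domain) (c d : ℝ) :
    S.valueA l (c • x + d • y) = c • S.valueA l x + d • S.valueA l y ∧
    S.valueB l (c • x + d • y) = c • S.valueB l x + d • S.valueB l y ∧
    S.interfaceFlow l (c • x + d • y) = c * S.interfaceFlow l x + d * S.interfaceFlow l y ∧
    S.interfaceEffort l (c • x + d • y) =
      c * S.interfaceEffort l x + d * S.interfaceEffort l y := by
  have hab := S.a_neg.trans S.b_pos
  have hal := l.2.1
  have hlb := l.2.2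
  have k1 := S.coeFn_comb (S.comp 1 x) (S.comp 1 y) c d
  have k0 := S.coeFn_comb (S.comp 0 x) (S.comp 0 y) c d
  have c1 : ∀ z ∈ Icc S.a S.b, contRep S.a S.b (S.comp 1 (c • x + d • y)) z =
      c * contRep S.a S.b (S.comp 1 x) z + d * contRep S.a S.b (S.comp 1 y) z := by
    intro z hz
    rw [map_add, map_smul, map_smul]
    exact contRep_comb hx.2 hy.2 c d k1 hab hz
  have cl : ∀ z ∈ Icc S.a (l : ℝ), contRep S.a l (S.comp 0 (c • x + d • y)) z =
      c * contRep S.a l (S.comp 0 x) z + d * contRep S.a l (S.comp 0 y) z := by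
    intro z hz
    rw [map_add, map_smul, map_smul]
    exact contRep_comb hx.1.1 hy.1.1 c d (S.ae_left l k0) hal hz
  have cr : ∀ z ∈ Icc (l : ℝ) S.b, contRep l S.b (S.comp 0 (c • x + d • y)) z =
      c * contRep l S.b (S.comp 0 x) z + d * contRep l S.b (S.comp 0 y) z := by
    intro z hz
    rw [map_add, map_smul, map_smul]
    exact contRep_comb hx.1.2 hy.1.2 c d (S.ae_right l k0) hlb hz
  refine ⟨?_, ?_, ?_, ?_⟩
  · ext i
    fin_cases i
    · simpa [valueA] using cl S.a (left_mem_Icc.2 hal.le)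
    · simpa [valueA] using c1 S.a (left_mem_Icc.2 hab.le)
  · ext i
    fin_cases i
    · simpa [valueB] using cr S.b (right_mem_Icc.2 hlb.le)
    · simpa [valueB] using c1 S.b (right_mem_Icc.2 hab.le)
  · exact c1 l ⟨hal.le, hlb.le⟩
  · simp only [interfaceEffort]
    rw [cl l (right_mem_Icc.2 hal.le), cr l (left_mem_Icc.2 hlb.le)]
    ring

/-! #### The port-Hamiltonian operator -/

/-- The vector `(f_∂, e_∂) ∈ ℝ⁴ = ℝ² ⊕ ℝ²`. -/
noncomputable def boundaryPort (l : S.Position) (y : S.X) : Fin 2 ⊕ Fin 2 → ℝ :=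
  Sum.elim (S.boundaryFlow l y) (S.boundaryEffort l y)

theorem boundaryPort_comb (l : S.Position) {x y : S.X} (hx : x ∈ (S.J l).domain)
    (hy : y ∈ (S.J l).domain) (c d : ℝ) :
    S.boundaryPort l (c • x + d • y) = c • S.boundaryPort l x + d • S.boundaryPort l y := by
  obtain ⟨hA, hB, -, -⟩ := S.trace_comb l hx hy c d
  ext i
  rcases i with i | i
  · have e : c • S.valueB l x + d • S.valueB l y - (c • S.valueA l x + d • S.valueA l y) =
        c • (S.valueB l x - S.valueA l x) + d • (S.valueB l y - S.valueA l y) := by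
      simp only [smul_sub]
      abel
    simp only [boundaryPort, boundaryFlow, hA, hB, e, Matrix.mulVec_add, Matrix.mulVec_smul,
      Sum.elim_inl, Pi.add_apply, Pi.smul_apply, smul_eq_mul]
    ring
  · simp only [boundaryPort, boundaryEffort, hA, hB,
      Sum.elim_inr, Pi.add_apply, Pi.smul_apply, smul_eq_mul]
    ring

/-- The domain of `A_{Q_l}`: all `x ∈ X` with `Q_l x ∈ D(J_l)`, `f_I = r e_I` and
`W_B (f_∂, e_∂) = 0`. -/
noncomputable def phDomain (r : ℝ) (W : Matrix (Fin 2) (Fin 2 ⊕ Fin 2) ℝ) (l : S.Position) :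
    Submodule ℝ S.X :=
  combSubmodule
    (fun x => S.mulQ l x ∈ (S.J l).domain ∧
      S.interfaceFlow l (S.mulQ l x) = r * S.interfaceEffort l (S.mulQ l x) ∧
      Matrix.mulVec W (S.boundaryPort l (S.mulQ l x)) = 0)
    (by
      have h0 : (0 : S.X) ∈ (S.J l).domain := Submodule.zero_mem _
      have ht := S.trace_comb l h0 h0 0 0
      have hp := S.boundaryPort_comb l h0 h0 0 0
      simp only [zero_smul, zero_mul, add_zero] at ht hp
      rw [map_zero]
      refine ⟨h0, ?_, ?_⟩
      · rw [ht.2.2.1, ht.2.2.2, mul_zero]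
      · rw [hp, Matrix.mulVec_zero])
    (by
      intro x y hx hy c d
      have ht := S.trace_comb l hx.1 hy.1 c d
      have hp := S.boundaryPort_comb l hx.1 hy.1 c d
      rw [map_add, map_smul, map_smul]
      refine ⟨Submodule.add_mem _ (Submodule.smul_mem _ _ hx.1) (Submodule.smul_mem _ _ hy.1),
        ?_, ?_⟩
      · rw [ht.2.2.1, ht.2.2.2, hx.2.1, hy.2.1]
        ring
      · rw [hp, Matrix.mulVec_add, Matrix.mulVec_smul, Matrix.mulVec_smul, hx.2.2, hy.2.2]
        simp)

/-- The port-Hamiltonian operator `A_{Q_l} x = J_l (Q_l x)`, as an operator on the energy space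
`(X, ‖·‖_{Q_0})`. -/
noncomputable def phOperator (r : ℝ) (W : Matrix (Fin 2) (Fin 2 ⊕ Fin 2) ℝ) (l : S.Position) :
    S.EnergySpace 0 →ₗ.[ℝ] S.EnergySpace 0 where
  domain := (S.phDomain r W l).comap (S.toX 0).toLinearMap
  toFun := combLinearMap
    (fun x => (S.toX 0).symm (S.J l ⟨S.mulQ l (S.toX 0 x), x.2.1⟩))
    (by
      intro x y c d
      have e : (⟨S.mulQ l (S.toX 0 (c • x + d • y : S.EnergySpace 0)),
          (c • x + d • y).2.1⟩ : (S.J l).domain) =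
          c • ⟨S.mulQ l (S.toX 0 x), x.2.1⟩ + d • ⟨S.mulQ l (S.toX 0 y), y.2.1⟩ := by
        ext1
        simp
      change (S.toX 0).symm (S.J l ⟨S.mulQ l (S.toX 0 (c • x + d • y : S.EnergySpace 0)),
          (c • x + d • y).2.1⟩) = _
      rw [e]
      simp only [LinearPMap.map_add, LinearPMap.map_smul, map_add, map_smul])

/-- Assumption on the coefficients: `Q^± ∈ C¹([a, b], ℝ^{2×2})` are diagonal,
`(q₁₁⁺ / q₁₁⁻)(0) = 1`, and `q₁₁⁺ / q₁₁⁻ = q₂₂⁺ / q₂₂⁻` on `[a, b]`. -/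
structure CoefficientAssumption : Prop where
  contDiffOn_Qm : ∀ i j, ContDiffOn ℝ 1 (fun z => S.Qm z i j) (Icc S.a S.b)
  contDiffOn_Qp : ∀ i j, ContDiffOn ℝ 1 (fun z => S.Qp z i j) (Icc S.a S.b)
  isDiag_Qm : ∀ z ∈ Icc S.a S.b, (S.Qm z).IsDiag
  isDiag_Qp : ∀ z ∈ Icc S.a S.b, (S.Qp z).IsDiag
  ratio_zero : S.Qp 0 0 0 / S.Qm 0 0 0 = 1
  ratio_eq : ∀ z ∈ Icc S.a S.b, S.Qp z 0 0 / S.Qm z 0 0 = S.Qp z 1 1 / S.Qm z 1 1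

end InterfaceSystem

/-- The matrix `Σ = [[0, I₂], [I₂, 0]] ∈ ℝ^{4×4}`. -/
def portSigma : Matrix (Fin 2 ⊕ Fin 2) (Fin 2 ⊕ Fin 2) ℝ := Matrix.fromBlocks 0 1 1 0

/-- Assumption on the interface and boundary conditions: `r = 0`, `rank W_B = 2` and
`W_B Σ W_Bᵀ ≥ 0`. -/
structure BoundaryAssumption (r : ℝ) (W : Matrix (Fin 2) (Fin 2 ⊕ Fin 2) ℝ) : Prop where
  r_eq_zero : r = 0
  rank_eq : W.rank = 2
  posSemidef : (W * portSigma * W.transpose).PosSemidef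

/-! Everything rests on one Hilbert-space principle. If `⟨A x, x⟩ ≤ ω ‖x‖²` on the domain and `lam -
A` is onto for every `lam > ω`, then `‖R(lam, A)‖ ≤ 1 / (lam - ω)` and `A` generates a semigroup
bounded by `exp (ω s)` (Lumer–Phillips, proved by Yosida approximation). When every `A(t)` satisfies
this in the same norm with the same `ω`, products of resolvents are bounded factor by factor, which
is Kato-stability with constant 1. So two facts about `A_{Q_l}` are needed in the fixed norm
`‖·‖_{Q_0}`.

Dissipativity (`exists_isQuasiDissipative`). Since `Q^±` are diagonal with equal ratios of diagonal
entries, `Q_0 = φ Q_l` with a scalar weight `φ`. It is Lipschitz on either side of `l`, with a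
constant independent of `l`, and equals 1 at `a` and `b` because the ratio is 1 at 0. With `y = Q_l
x`, the form `⟨A x, x⟩_{Q_0}` is `-½ ∫ φ (y₁ y₂)'`, taken piecewise. Integration by parts
(`inner_J_le`) leaves three contributions. The terms at `l` vanish since `r = 0` means `y₂(l) = 0`,
whatever the jumps of `φ` and `y₁`. The terms at `a` and `b` form the boundary power, nonpositive by
the assumption on `W_B` (`flow_mul_effort_nonpos`). The integral of `φ' y₁ y₂` is dominated by a
multiple of `‖y‖²`, hence of the energy.

Range (`hasFullRange_phOperator`). For `J_l` with the interface and boundary conditions, `mu y - J_l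
y = g` is a linear ODE system: a particular solution is corrected by a two-parameter homogeneous
family, and dissipativity makes the resulting 2×2 boundary problem uniquely solvable
(`hasFullRange_Jbc`). The factor `Q_l` is then inserted by a contraction argument for coercive
perturbations (`exists_sub_comp_coercive_eq`). -/

namespace Evolution

/-! ### Resolvents of quasi-dissipative operators with full range -/

section Hilbert

variable {H : Type*} [NormedAddCommGroup H] [InnerProductSpace ℝ H]

/-- `A` is quasi-dissipative with constant `ω`: `⟨A x, x⟩ ≤ ω ‖x‖²` on the domain. -/
def IsQuasiDissipative (A : H →ₗ.[ℝ] H) (ω : ℝ) : Prop :=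
  ∀ x : A.domain, inner ℝ (A x) (x : H) ≤ ω * ‖(x : H)‖ ^ 2

/-- `lam - A` is onto for all `lam > ω`. -/
def HasFullRange (A : H →ₗ.[ℝ] H) (ω : ℝ) : Prop :=
  ∀ lam : ℝ, ω < lam → ∀ y : H, ∃ x : A.domain, lam • (x : H) - A x = y

variable {A : H →ₗ.[ℝ] H} {ω : ℝ}

/-- Pairing `(lam - A) x` with `x` and applying Cauchy–Schwarz gives the bound. The absence of any
further constant here is what makes the stability constant equal to 1. -/
theorem IsQuasiDissipative.norm_le (hA : IsQuasiDissipative A ω) {lam : ℝ} (x : A.domain) :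
    (lam - ω) * ‖(x : H)‖ ≤ ‖lam • (x : H) - A x‖ := by
  rcases (norm_nonneg (x : H)).eq_or_lt with h | h
  · rw [← h, mul_zero]
    exact norm_nonneg _
  · have h1 := real_inner_le_norm (lam • (x : H) - A x) (x : H)
    have h2 := hA x
    rw [inner_sub_left, real_inner_smul_left, real_inner_self_eq_norm_sq] at h1
    nlinarith

theorem IsResolventAt.norm_apply_le {lam : ℝ} {R : H →L[ℝ] H} (hR : IsResolventAt A lam R)
    (hA : IsQuasiDissipative A ω) (y : H) : (lam - ω) * ‖R y‖ ≤ ‖y‖ := by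
  obtain ⟨h, e⟩ := hR.1 y
  have := hA.norm_le (lam := lam) ⟨R y, h⟩
  rwa [e] at this

theorem IsResolventAt.norm_le {lam : ℝ} {R : H →L[ℝ] H} (hR : IsResolventAt A lam R)
    (hA : IsQuasiDissipative A ω) (hlam : ω < lam) : ‖R‖ ≤ 1 / (lam - ω) := by
  have h0 : 0 < lam - ω := sub_pos.2 hlam
  refine R.opNorm_le_bound (by positivity) fun y => ?_
  have := hR.norm_apply_le hA y
  rw [div_mul_eq_mul_div, one_mul, le_div_iff₀ h0]
  linarith

/-- Dissipativity bounds `lam - A` from below, hence gives injectivity and a bounded inverse; the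
range condition gives surjectivity. -/
theorem exists_isResolventAt (hA : IsQuasiDissipative A ω) (hr : HasFullRange A ω) {lam : ℝ}
    (hlam : ω < lam) : ∃ R : H →L[ℝ] H, IsResolventAt A lam R := by
  have h0 : 0 < lam - ω := sub_pos.2 hlam
  let L : A.domain →ₗ[ℝ] H := lam • A.domain.subtype - A.toFun
  have hL : ∀ x : A.domain, L x = lam • (x : H) - A x := fun x => rfl
  have hinj : Function.Injective L := by
    rw [injective_iff_map_eq_zero]
    intro x hx
    have := hA.norm_le (lam := lam) x
    rw [← hL, hx, norm_zero] at this
    have h1 : ‖(x : H)‖ ≤ 0 := by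
      by_contra hc
      have := mul_pos h0 (not_le.1 hc)
      linarith
    exact Subtype.ext (norm_le_zero_iff.1 h1)
  let e : A.domain ≃ₗ[ℝ] H := LinearEquiv.ofBijective L ⟨hinj, fun y => hr lam hlam y⟩
  have he : ∀ x : A.domain, e x = lam • (x : H) - A x := fun x => rfl
  refine ⟨LinearMap.mkContinuous (A.domain.subtype ∘ₗ e.symm.toLinearMap) (lam - ω)⁻¹ ?_, ?_, ?_⟩
  · intro y
    have := hA.norm_le (lam := lam) (e.symm y)
    rw [← he, LinearEquiv.apply_symm_apply] at this
    rw [inv_mul_eq_div, le_div_iff₀ h0, mul_comm]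
    exact this
  · intro y
    refine ⟨(e.symm y).2, ?_⟩
    have := he (e.symm y)
    rw [LinearEquiv.apply_symm_apply] at this
    exact this.symm
  · intro x
    change ((e.symm (lam • (x : H) - A x) : A.domain) : H) = x
    rw [← he, LinearEquiv.symm_apply_apply]

theorem resolvent_spec {lam : ℝ} (h : lam ∈ resolventSet A) :
    IsResolventAt A lam (resolvent A lam) := by
  rw [resolvent, dif_pos h]
  exact h.choose_spec

/-- A vector `z` orthogonal to the domain has the form `(ω + 1) x - A x`. Pairing with `x` yields `0
≥ ‖x‖²`, so `x = 0` and `z = 0`. Density is therefore not a separate hypothesis. -/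
theorem dense_domain [CompleteSpace H] (hA : IsQuasiDissipative A ω) (hr : HasFullRange A ω) :
    Dense (A.domain : Set H) := by
  rw [Submodule.dense_iff_topologicalClosure_eq_top, Submodule.topologicalClosure_eq_top_iff,
    Submodule.eq_bot_iff]
  intro z hz
  obtain ⟨x, hx⟩ := hr (ω + 1) (by linarith) z
  have h1 := (Submodule.mem_orthogonal _ _).1 hz x x.2
  have h2 := hA x
  rw [← hx, inner_sub_right, real_inner_smul_right, real_inner_self_eq_norm_sq,
    real_inner_comm] at h1
  have h3 : (x : H) = 0 := by
    rw [← norm_eq_zero, ← sq_eq_zero_iff]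
    nlinarith [sq_nonneg ‖(x : H)‖]
  have h4 : x = 0 := Subtype.ext h3
  rw [← hx, h4]
  simp

/-! ### Contraction semigroups with bounded generators -/

/-- The uniformly continuous semigroup `exp (t B)`. -/
noncomputable def expSG (B : H →L[ℝ] H) (t : ℝ) : H →L[ℝ] H := NormedSpace.exp (t • B)

theorem expSG_zero (B : H →L[ℝ] H) : expSG B 0 = 1 := by
  rw [expSG, zero_smul, NormedSpace.exp_zero]

theorem commute_expSG {B C : H →L[ℝ] H} (h : Commute C B) (t : ℝ) : Commute C (expSG B t) :=
  (h.smul_right t).exp_right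

variable [CompleteSpace H]

theorem expSG_add (B : H →L[ℝ] H) (s t : ℝ) : expSG B (s + t) = expSG B s * expSG B t := by
  let _ : NormedAlgebra ℚ (H →L[ℝ] H) := NormedAlgebra.restrictScalars ℚ ℝ _
  rw [expSG, add_smul, NormedSpace.exp_add_of_commute]
  · rfl
  · exact ((Commute.refl B).smul_left s).smul_right t

theorem hasDerivAt_expSG (B : H →L[ℝ] H) (t : ℝ) :
    HasDerivAt (expSG B) (expSG B t * B) t :=
  hasDerivAt_exp_smul_const B t

theorem hasDerivAt_expSG_apply (B : H →L[ℝ] H) (x : H) (t : ℝ) :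
    HasDerivAt (fun s => expSG B s x) (expSG B t (B x)) t := by
  have := (hasDerivAt_expSG B t).clm_apply (hasDerivAt_const t x)
  simpa using this

/-- The derivative of `‖exp (s B) x‖²` is `2 ⟨B w, w⟩ ≤ 0` with `w = exp (s B) x`. -/
theorem norm_expSG_apply_le {B : H →L[ℝ] H} (hB : ∀ x, inner ℝ (B x) x ≤ 0) {t : ℝ} (ht : 0 ≤ t)
    (x : H) : ‖expSG B t x‖ ≤ ‖x‖ := by
  have hd : ∀ s, HasDerivAt (fun s => ‖expSG B s x‖ ^ 2)
      (2 * inner ℝ (expSG B s x) (expSG B s (B x))) s :=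
    fun s => (hasDerivAt_expSG_apply B x s).norm_sq
  have hanti : AntitoneOn (fun s => ‖expSG B s x‖ ^ 2) (Icc 0 t) := by
    refine antitoneOn_of_deriv_nonpos (convex_Icc _ _)
      (fun s _ => (hd s).continuousAt.continuousWithinAt)
      (fun s _ => (hd s).differentiableAt.differentiableWithinAt) fun s _ => ?_
    rw [(hd s).deriv]
    have hc : expSG B s (B x) = B (expSG B s x) :=
      (DFunLike.congr_fun (commute_expSG (Commute.refl B) s).eq x).symm
    rw [hc, real_inner_comm]
    linarith [hB (expSG B s x)]
  have := hanti (left_mem_Icc.2 ht) (right_mem_Icc.2 ht) ht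
  simp only [expSG_zero, one_apply_eq_self] at this
  exact (sq_le_sq₀ (norm_nonneg _) (norm_nonneg _)).1 this

/-- The path `s ↦ exp (s B) exp ((t - s) C) x` joins the two vectors. By commutativity its
derivative is two contractions applied to `B x - C x`, so the mean value inequality applies. -/
theorem norm_expSG_sub_le {B C : H →L[ℝ] H} (hB : ∀ x, inner ℝ (B x) x ≤ 0)
    (hC : ∀ x, inner ℝ (C x) x ≤ 0) (hBC : Commute B C) {t : ℝ} (ht : 0 ≤ t) (x : H) :
    ‖expSG B t x - expSG C t x‖ ≤ ‖B x - C x‖ * t := by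
  have hd : ∀ s, HasDerivAt (fun s => expSG B s (expSG C (t - s) x))
      (expSG B s (expSG C (t - s) (B x - C x))) s := by
    intro s
    have h1 : HasDerivAt (fun s => expSG C (t - s) x) (-(expSG C (t - s) (C x))) s := by
      have h := (hasDerivAt_expSG_apply C x (t - s)).scomp s ((hasDerivAt_id s).const_sub t)
      simpa [Function.comp_def] using h
    have h2 := (hasDerivAt_expSG B s).clm_apply h1
    have hc : B (expSG C (t - s) x) = expSG C (t - s) (B x) :=
      DFunLike.congr_fun (commute_expSG hBC (t - s)).eq x
    have e : (expSG B s * B) (expSG C (t - s) x) + expSG B s (-(expSG C (t - s) (C x))) =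
        expSG B s (expSG C (t - s) (B x - C x)) := by
      rw [mul_apply_eq_comp, hc, ← map_add, map_sub, ← sub_eq_add_neg]
    rwa [e] at h2
  have := norm_image_sub_le_of_norm_deriv_le_segment' (C := ‖B x - C x‖)
    (fun s (_ : s ∈ Icc 0 t) => (hd s).hasDerivWithinAt) (fun s hs =>
      (norm_expSG_apply_le hB hs.1 _).trans (norm_expSG_apply_le hC (by linarith [hs.2]) _))
    t (right_mem_Icc.2 ht)
  simpa [expSG_zero] using this

end Hilbert

section Hilbert

variable {H : Type*} [NormedAddCommGroup H] [InnerProductSpace ℝ H]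
variable {A : H →ₗ.[ℝ] H} {ω : ℝ}

/-! ### The Yosida approximation -/

/-- The Yosida approximation `lam (lam R - 1)` built from a resolvent `R` at `lam`. -/
noncomputable def yosida (lam : ℝ) (R : H →L[ℝ] H) : H →L[ℝ] H := lam • (lam • R - 1)

theorem yosida_apply (lam : ℝ) (R : H →L[ℝ] H) (x : H) :
    yosida lam R x = lam • (lam • R x - x) := rfl

theorem IsResolventAt.smul_sub {lam : ℝ} {R : H →L[ℝ] H} (hR : IsResolventAt A lam R)
    (x : A.domain) : lam • R x - x = R (A x) := by
  have := hR.2 x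
  rw [map_sub, map_smul] at this
  rw [sub_eq_iff_eq_add] at this ⊢
  rw [this, add_comm]

theorem IsResolventAt.yosida_eq {lam : ℝ} {R : H →L[ℝ] H} (hR : IsResolventAt A lam R)
    (x : A.domain) : yosida lam R x = lam • R (A x) := by
  rw [yosida_apply, hR.smul_sub]

theorem IsResolventAt.norm_smul_apply_le {lam : ℝ} {R : H →L[ℝ] H} (hR : IsResolventAt A lam R)
    (hA : IsQuasiDissipative A 0) (hlam : 0 < lam) (y : H) : ‖lam • R y‖ ≤ ‖y‖ := by
  have := hR.norm_apply_le hA y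
  rwa [sub_zero, ← abs_of_pos hlam, ← Real.norm_eq_abs, ← norm_smul] at this

theorem IsResolventAt.inner_yosida_le {lam : ℝ} {R : H →L[ℝ] H} (hR : IsResolventAt A lam R)
    (hA : IsQuasiDissipative A 0) (hlam : 0 < lam) (y : H) :
    inner ℝ (yosida lam R y) y ≤ 0 := by
  rw [yosida_apply, real_inner_smul_left, inner_sub_left, real_inner_self_eq_norm_sq]
  refine mul_nonpos_of_nonneg_of_nonpos hlam.le ?_
  have h1 := real_inner_le_norm (lam • R y) y
  have h2 := mul_le_mul_of_nonneg_right (hR.norm_smul_apply_le hA hlam y) (norm_nonneg y)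
  rw [sq]
  linarith

theorem IsResolventAt.resolvent_identity {lam mu : ℝ} {R S : H →L[ℝ] H}
    (hR : IsResolventAt A lam R) (hS : IsResolventAt A mu S) (y : H) :
    R y - S y = (mu - lam) • R (S y) := by
  obtain ⟨h, e⟩ := hS.1 y
  have h1 := hR.2 ⟨S y, h⟩
  have e2 : y = (lam • S y - A ⟨S y, h⟩) + (mu - lam) • S y := by
    rw [sub_smul]
    nth_rewrite 1 [← e]
    abel
  have h2 : R y = R (lam • S y - A ⟨S y, h⟩) + (mu - lam) • R (S y) := by
    rw [← map_smul R, ← map_add, ← e2]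
  rw [h2, h1]
  simp

theorem IsResolventAt.commute {lam mu : ℝ} {R S : H →L[ℝ] H}
    (hR : IsResolventAt A lam R) (hS : IsResolventAt A mu S) (hne : lam ≠ mu) :
    Commute R S := by
  ext y
  change R (S y) = S (R y)
  have h1 := hR.resolvent_identity hS y
  have h2 := hS.resolvent_identity hR y
  have h3 : (mu - lam) • R (S y) = (mu - lam) • S (R y) := by
    rw [← h1, ← neg_sub lam mu, neg_smul, ← h2, neg_sub]
  exact smul_right_injective H (sub_ne_zero.2 hne.symm) h3

theorem commute_yosida {lam mu : ℝ} {R S : H →L[ℝ] H} (h : Commute R S) :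
    Commute (yosida lam R) (yosida mu S) := by
  refine Commute.smul_left (Commute.smul_right ?_ _) _
  exact (((h.smul_left lam).smul_right mu).sub_right (Commute.one_right _)).sub_left
    (Commute.one_left _)

theorem tendsto_of_dense {R : ℕ → H →L[ℝ] H} {T : H →L[ℝ] H} {D : Set H} (hD : Dense D) {C : ℝ}
    (hR : ∀ n x, ‖R n x‖ ≤ C * ‖x‖) (hT : ∀ x, ‖T x‖ ≤ C * ‖x‖)
    (h : ∀ x ∈ D, Tendsto (fun n => R n x) atTop (𝓝 (T x))) (x : H) :
    Tendsto (fun n => R n x) atTop (𝓝 (T x)) := by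
  rw [Metric.tendsto_atTop]
  intro ε hε
  have hC : 0 < |C| + 1 := by positivity
  obtain ⟨y, hy, hxy⟩ := hD.exists_dist_lt x (ε := ε / (4 * (|C| + 1))) (by positivity)
  obtain ⟨N, hN⟩ := Metric.tendsto_atTop.1 (h y hy) (ε / 2) (by positivity)
  refine ⟨N, fun n hn => ?_⟩
  have h1 := hN n hn
  rw [dist_eq_norm] at h1 hxy ⊢
  have e : R n x - T x = R n (x - y) + (R n y - T y) - T (x - y) := by
    rw [map_sub, map_sub]
    abel
  rw [lt_div_iff₀ (by positivity)] at hxy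
  have h2 : C * ‖x - y‖ ≤ (|C| + 1) * ‖x - y‖ :=
    mul_le_mul_of_nonneg_right ((le_abs_self C).trans (by linarith)) (norm_nonneg _)
  rw [e]
  calc _ ≤ ‖R n (x - y)‖ + ‖R n y - T y‖ + ‖T (x - y)‖ :=
        (norm_sub_le _ _).trans (add_le_add_left (norm_add_le _ _) _)
    _ < ε := by linarith [hR n (x - y), hT (x - y)]

/-! ### Convergence of the Yosida semigroups and identification of the generator -/

/-- A sequence of resolvents of a dissipative operator at `n + 1`. -/
structure IsResolventSeq (A : H →ₗ.[ℝ] H) (R : ℕ → H →L[ℝ] H) : Prop where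
  dissipative : IsQuasiDissipative A 0
  dense : Dense (A.domain : Set H)
  spec : ∀ n : ℕ, IsResolventAt A (n + 1) (R n)

namespace IsResolventSeq

variable {R : ℕ → H →L[ℝ] H}

/-- On the domain the error is `R n (A x)`, of size `‖A x‖ / (n + 1)`. The uniform bound `‖(n + 1) R
n‖ ≤ 1` and density extend the convergence to all of `H`. -/
theorem tendsto_smul (hR : IsResolventSeq A R) (x : H) :
    Tendsto (fun n : ℕ => ((n : ℝ) + 1) • R n x) atTop (𝓝 x) := by
  have hb : ∀ (n : ℕ) (x : H), ‖(((n : ℝ) + 1) • R n) x‖ ≤ 1 * ‖x‖ := fun n x => by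
    rw [one_mul]
    exact (hR.spec n).norm_smul_apply_le hR.dissipative (by positivity) x
  refine tendsto_of_dense (R := fun n => ((n : ℝ) + 1) • R n) (T := ContinuousLinearMap.id ℝ H)
    hR.dense hb (fun x => by simp) (fun x hx => ?_) x
  rw [tendsto_iff_norm_sub_tendsto_zero]
  have hlim : Tendsto (fun n : ℕ => ‖A ⟨x, hx⟩‖ * (1 / ((n : ℝ) + 1))) atTop (𝓝 0) := by
    simpa using tendsto_one_div_add_atTop_nhds_zero_nat.const_mul ‖A ⟨x, hx⟩‖
  refine squeeze_zero (fun _ => norm_nonneg _) (fun n => ?_) hlim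
  have h1 := (hR.spec n).smul_sub ⟨x, hx⟩
  have h2 := (hR.spec n).norm_apply_le hR.dissipative (A ⟨x, hx⟩)
  change ‖((n : ℝ) + 1) • R n x - x‖ ≤ _
  rw [h1, mul_one_div, le_div_iff₀ (by positivity)]
  linarith

theorem tendsto_yosida (hR : IsResolventSeq A R) (x : A.domain) :
    Tendsto (fun n : ℕ => yosida (n + 1) (R n) x) atTop (𝓝 (A x)) := by
  simp_rw [fun n => (hR.spec n).yosida_eq x]
  exact hR.tendsto_smul (A x)

theorem inner_yosida_le (hR : IsResolventSeq A R) (n : ℕ) (x : H) :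
    inner ℝ (yosida (n + 1) (R n) x) x ≤ 0 :=
  (hR.spec n).inner_yosida_le hR.dissipative (by positivity) x

theorem commute (hR : IsResolventSeq A R) (n k : ℕ) :
    Commute (yosida (n + 1) (R n)) (yosida (k + 1) (R k)) := by
  rcases eq_or_ne n k with rfl | h
  · exact Commute.refl _
  · refine commute_yosida ((hR.spec n).commute (hR.spec k) ?_)
    simpa using h

variable [CompleteSpace H]

/-- For `y` in the domain the semigroups differ by at most `t` times the difference of the Yosida
approximations at `y`, which converge to `A y`. A general `x` costs a further `2 ‖x - y‖` by
contractivity. -/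
theorem cauchySeq (hR : IsResolventSeq A R) {t : ℝ} (ht : 0 ≤ t) (x : H) :
    CauchySeq (fun n : ℕ => expSG (yosida (n + 1) (R n)) t x) := by
  rw [Metric.cauchySeq_iff]
  intro ε hε
  obtain ⟨y, hy, hxy⟩ := hR.dense.exists_dist_lt x (ε := ε / 4) (by positivity)
  obtain ⟨N, hN⟩ := Metric.cauchySeq_iff.1 (hR.tendsto_yosida ⟨y, hy⟩).cauchySeq
    (ε / (2 * (t + 1))) (by positivity)
  refine ⟨N, fun n hn k hk => ?_⟩
  have h1 := hN n hn k hk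
  rw [dist_eq_norm] at h1 hxy ⊢
  rw [lt_div_iff₀ (by positivity)] at h1
  have h2 := norm_expSG_sub_le (hR.inner_yosida_le n) (hR.inner_yosida_le k) (hR.commute n k) ht y
  have h3 := norm_expSG_apply_le (hR.inner_yosida_le n) ht (x - y)
  have h4 := norm_expSG_apply_le (hR.inner_yosida_le k) ht (x - y)
  set U := expSG (yosida (n + 1) (R n)) t
  set V := expSG (yosida (k + 1) (R k)) t
  have e : U x - V x = U (x - y) + (U y - V y) - V (x - y) := by
    rw [map_sub, map_sub]
    abel
  rw [e]
  calc _ ≤ ‖U (x - y)‖ + ‖U y - V y‖ + ‖V (x - y)‖ :=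
        (norm_sub_le _ _).trans (add_le_add_left (norm_add_le _ _) _)
    _ < ε := by
        nlinarith [norm_nonneg (yosida (n + 1) (R n) y - yosida (k + 1) (R k) y)]

theorem exists_limit (hR : IsResolventSeq A R) : ∃ T : ℝ → H →L[ℝ] H, ∀ t : ℝ, 0 ≤ t → ∀ x,
    Tendsto (fun n : ℕ => expSG (yosida (n + 1) (R n)) t x) atTop (𝓝 (T t x)) := by
  have h : ∀ t : ℝ, ∃ T : H →L[ℝ] H, 0 ≤ t → ∀ x,
      Tendsto (fun n : ℕ => expSG (yosida (n + 1) (R n)) t x) atTop (𝓝 (T x)) := by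
    intro t
    by_cases ht : 0 ≤ t
    · choose f hf using fun x => cauchySeq_tendsto_of_complete (hR.cauchySeq ht x)
      exact ⟨continuousLinearMapOfTendsto (fun n : ℕ => expSG (yosida (n + 1) (R n)) t)
        (tendsto_pi_nhds.2 hf), fun _ x => hf x⟩
    · exact ⟨0, fun h => absurd h ht⟩
  choose T hT using h
  exact ⟨T, hT⟩

section Limit

variable {T : ℝ → H →L[ℝ] H}

theorem norm_limit_apply_le (hR : IsResolventSeq A R)
    (hT : ∀ t : ℝ, 0 ≤ t → ∀ x,
      Tendsto (fun n : ℕ => expSG (yosida (n + 1) (R n)) t x) atTop (𝓝 (T t x)))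
    {t : ℝ} (ht : 0 ≤ t) (x : H) : ‖T t x‖ ≤ ‖x‖ :=
  le_of_tendsto (hT t ht x).norm
    (Eventually.of_forall fun n => norm_expSG_apply_le (hR.inner_yosida_le n) ht x)

theorem norm_limit_sub_le (hR : IsResolventSeq A R)
    (hT : ∀ t : ℝ, 0 ≤ t → ∀ x,
      Tendsto (fun n : ℕ => expSG (yosida (n + 1) (R n)) t x) atTop (𝓝 (T t x)))
    {t : ℝ} (ht : 0 ≤ t) (x : A.domain) : ‖T t x - x‖ ≤ ‖A x‖ * t := by
  refine le_of_tendsto_of_tendsto ((hT t ht x).sub_const (x : H)).norm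
    ((hR.tendsto_yosida x).norm.mul_const t) (Eventually.of_forall fun n => ?_)
  have := norm_expSG_sub_le (C := 0) (hR.inner_yosida_le n) (by simp) (Commute.zero_right _) ht
    (x : H)
  simpa [expSG] using this

theorem tendsto_limit_zero (hR : IsResolventSeq A R)
    (hT : ∀ t : ℝ, 0 ≤ t → ∀ x,
      Tendsto (fun n : ℕ => expSG (yosida (n + 1) (R n)) t x) atTop (𝓝 (T t x))) (x : H) :
    Tendsto (fun t => T t x) (𝓝[>] 0) (𝓝 x) := by
  rw [Metric.tendsto_nhdsWithin_nhds]
  intro ε hε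
  obtain ⟨y, hy, hxy⟩ := hR.dense.exists_dist_lt x (ε := ε / 4) (by positivity)
  refine ⟨ε / (2 * (‖A ⟨y, hy⟩‖ + 1)), by positivity, fun t ht htd => ?_⟩
  have ht0 : (0 : ℝ) < t := ht
  rw [Real.dist_eq, sub_zero, abs_of_pos ht0, lt_div_iff₀ (by positivity)] at htd
  rw [dist_eq_norm] at hxy ⊢
  have h1 := hR.norm_limit_sub_le hT ht0.le ⟨y, hy⟩
  have h2 := hR.norm_limit_apply_le hT ht0.le (x - y)
  have e : T t x - x = T t (x - y) + (T t y - y) - (x - y) := by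
    rw [map_sub]
    abel
  rw [e]
  calc _ ≤ ‖T t (x - y)‖ + ‖T t y - y‖ + ‖x - y‖ :=
        (norm_sub_le _ _).trans (add_le_add_left (norm_add_le _ _) _)
    _ < ε := by
        change ‖T t y - y‖ ≤ _ at h1
        nlinarith

theorem isC0Semigroup_limit (hR : IsResolventSeq A R)
    (hT : ∀ t : ℝ, 0 ≤ t → ∀ x,
      Tendsto (fun n : ℕ => expSG (yosida (n + 1) (R n)) t x) atTop (𝓝 (T t x))) :
    IsC0Semigroup T where
  map_zero := by
    ext x
    refine tendsto_nhds_unique (hT 0 le_rfl x) ?_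
    simp [expSG_zero]
  map_add s t hs ht := by
    ext x
    refine tendsto_nhds_unique (hT (s + t) (add_nonneg hs ht) x) ?_
    have h1 : Tendsto (fun n : ℕ => expSG (yosida (n + 1) (R n)) s
        (expSG (yosida (n + 1) (R n)) t x - T t x)) atTop (𝓝 0) := by
      refine squeeze_zero_norm
        (fun n => norm_expSG_apply_le (hR.inner_yosida_le n) hs _) ?_
      exact tendsto_iff_norm_sub_tendsto_zero.1 (hT t ht x)
    have h2 := h1.add (hT s hs (T t x))
    rw [zero_add] at h2
    refine h2.congr fun n => ?_
    rw [expSG_add, mul_apply_eq_comp, map_sub, sub_add_cancel]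
  tendsto_zero := hR.tendsto_limit_zero hT

theorem tendsto_slope_limit (hR : IsResolventSeq A R)
    (hT : ∀ t : ℝ, 0 ≤ t → ∀ x,
      Tendsto (fun n : ℕ => expSG (yosida (n + 1) (R n)) t x) atTop (𝓝 (T t x))) (x : A.domain) :
    Tendsto (fun h : ℝ => h⁻¹ • (T h x - x)) (𝓝[>] 0) (𝓝 (A x)) := by
  rw [Metric.tendsto_nhdsWithin_nhds]
  intro ε hε
  set y := A x
  obtain ⟨z, hz, hyz⟩ := hR.dense.exists_dist_lt y (ε := ε / 8) (by positivity)
  refine ⟨ε / (2 * (‖A ⟨z, hz⟩‖ + 1)), by positivity, fun t ht htd => ?_⟩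
  have ht0 : (0 : ℝ) < t := ht
  rw [Real.dist_eq, sub_zero, abs_of_pos ht0, lt_div_iff₀ (by positivity)] at htd
  rw [dist_eq_norm] at hyz ⊢
  -- A bound uniform in `n`, from the mean value inequality for `s ↦ exp (s B) x - s • y`. The
  -- vector `y = A x` need not lie in the domain, so it is replaced by a nearby `z` in the domain,
  -- for which the Yosida approximations stay bounded.
  have key : ∀ n : ℕ, ‖expSG (yosida (n + 1) (R n)) t x - x - t • y‖ ≤
      (‖yosida (n + 1) (R n) x - y‖ + 2 * ‖y - z‖ + ‖yosida (n + 1) (R n) z‖ * t) * t := by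
    intro n
    have hdn := hR.inner_yosida_le n
    set B := yosida (n + 1) (R n)
    have hd : ∀ s, HasDerivAt (fun s : ℝ => expSG B s x - s • y) (expSG B s (B x) - y) s := by
      intro s
      have := (hasDerivAt_expSG_apply B x s).fun_sub ((hasDerivAt_id s).smul_const y)
      simpa using this
    have := norm_image_sub_le_of_norm_deriv_le_segment'
      (C := ‖B x - y‖ + 2 * ‖y - z‖ + ‖B z‖ * t)
      (fun s (_ : s ∈ Icc 0 t) => (hd s).hasDerivWithinAt) (fun s hs => ?_)
      t (right_mem_Icc.2 ht0.le)
    · simp only [expSG_zero, one_apply_eq_self, zero_smul, sub_zero] at this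
      rwa [sub_right_comm]
    · have e : expSG B s (B x) - y = expSG B s (B x - y) + expSG B s (y - z) +
          (expSG B s z - z) - (y - z) := by
        rw [map_sub, map_sub]
        abel
      have h1 := norm_expSG_apply_le hdn hs.1 (B x - y)
      have h2 := norm_expSG_apply_le hdn hs.1 (y - z)
      have h3 : ‖expSG B s z - z‖ ≤ ‖B z‖ * s := by
        have := norm_expSG_sub_le (C := 0) hdn (by simp) (Commute.zero_right _) hs.1 z
        simpa [expSG] using this
      have h4 : ‖B z‖ * s ≤ ‖B z‖ * t := mul_le_mul_of_nonneg_left hs.2.le (norm_nonneg _)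
      rw [e]
      refine (norm_sub_le _ _).trans ?_
      refine (add_le_add_left (norm_add₃_le) _).trans ?_
      linarith
  have hlim : ‖T t x - x - t • y‖ ≤ (0 + 2 * ‖y - z‖ + ‖A ⟨z, hz⟩‖ * t) * t := by
    refine le_of_tendsto_of_tendsto (((hT t ht0.le x).sub_const (x : H)).sub_const (t • y)).norm
      ?_ (Eventually.of_forall key)
    exact (((tendsto_iff_norm_sub_tendsto_zero.1 (hR.tendsto_yosida x)).add_const _).add
      ((hR.tendsto_yosida ⟨z, hz⟩).norm.mul_const t)).mul_const t
  have e : t⁻¹ • (T t x - x) - y = t⁻¹ • (T t x - x - t • y) := by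
    rw [smul_sub t⁻¹ (T t x - x), smul_smul, inv_mul_cancel₀ ht0.ne', one_smul]
  rw [e, norm_smul, norm_inv, Real.norm_eq_abs, abs_of_pos ht0, inv_mul_lt_iff₀ ht0, mul_comm t]
  refine hlim.trans_lt ?_
  refine mul_lt_mul_of_pos_right ?_ ht0
  nlinarith

theorem isGeneratorOf_limit (hR : IsResolventSeq A R)
    (hT : ∀ t : ℝ, 0 ≤ t → ∀ x,
      Tendsto (fun n : ℕ => expSG (yosida (n + 1) (R n)) t x) atTop (𝓝 (T t x))) :
    IsGeneratorOf A T := by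
  intro x y
  rw [LinearPMap.mem_graph_iff]
  constructor
  · rintro ⟨x', rfl, rfl⟩
    exact hR.tendsto_slope_limit hT x'
  · intro h
    -- The index 0 is the resolvent at 1: it yields `x'` in the domain with `x' - A x' = x - y`. It
    -- remains to show `x' = x`.
    have hs := hR.spec 0
    obtain ⟨hx', e⟩ := hs.1 (x - y)
    set x' : A.domain := ⟨R 0 (x - y), hx'⟩
    have e' : x - x' = y - A x' := by
      have : ((0 : ℕ) : ℝ) + 1 = 1 := by norm_num
      rw [this, one_smul] at e
      change (x' : H) - A x' = x - y at e
      rw [sub_eq_sub_iff_add_eq_add] at e ⊢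
      rw [add_comm, add_comm y, e, add_comm]
    have h1 := h.sub (hR.tendsto_slope_limit hT x')
    -- The generator of a contraction semigroup is dissipative, as `⟨T t w - w, w⟩ ≤ 0`. Since `y -
    -- A x'` equals `x - x'`, this reads `‖x - x'‖² ≤ 0`.
    have h2 : inner ℝ (y - A x') (x - x') ≤ 0 := by
      refine le_of_tendsto (h1.inner tendsto_const_nhds) ?_
      filter_upwards [self_mem_nhdsWithin] with t ht
      have ht0 : (0 : ℝ) < t := ht
      rw [← smul_sub, real_inner_smul_left]
      refine mul_nonpos_of_nonneg_of_nonpos (inv_nonneg.2 ht0.le) ?_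
      have e2 : T t x - x - (T t x' - x') = T t (x - x') - (x - x') := by
        rw [map_sub]
        abel
      rw [e2, inner_sub_left, real_inner_self_eq_norm_sq, sq]
      have h3 := real_inner_le_norm (T t (x - x')) (x - x')
      have h4 := mul_le_mul_of_nonneg_right (hR.norm_limit_apply_le hT ht0.le (x - x'))
        (norm_nonneg (x - x'))
      linarith
    rw [← e', real_inner_self_eq_norm_sq] at h2
    have h3 : x - x' = 0 := by
      rw [← norm_eq_zero, ← sq_eq_zero_iff]
      exact le_antisymm h2 (sq_nonneg _)
    exact ⟨x', (sub_eq_zero.1 h3).symm, (sub_eq_zero.1 (e'.symm.trans h3)).symm⟩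

end Limit

end IsResolventSeq

end Hilbert

section Hilbert

variable {H : Type*} [NormedAddCommGroup H] [InnerProductSpace ℝ H]

/-! ### Generation theorem and Kato-stability -/

/-- The operator `A - ω`. -/
def shift (A : H →ₗ.[ℝ] H) (ω : ℝ) : H →ₗ.[ℝ] H where
  domain := A.domain
  toFun := A.toFun - ω • A.domain.subtype

variable {A : H →ₗ.[ℝ] H} {ω : ℝ}

theorem IsQuasiDissipative.shift (hA : IsQuasiDissipative A ω) :
    IsQuasiDissipative (shift A ω) 0 := by
  intro x
  have := hA x
  change inner ℝ (A x - ω • (x : H)) (x : H) ≤ _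
  rw [inner_sub_left, real_inner_smul_left, real_inner_self_eq_norm_sq]
  linarith

theorem HasFullRange.shift (hr : HasFullRange A ω) : HasFullRange (shift A ω) 0 := by
  intro lam hlam y
  obtain ⟨x, hx⟩ := hr (lam + ω) (by linarith) y
  refine ⟨x, ?_⟩
  change lam • (x : H) - (A x - ω • (x : H)) = y
  rw [← hx, add_smul]
  abel

theorem exists_isResolventSeq [CompleteSpace H] (hA : IsQuasiDissipative A 0)
    (hr : HasFullRange A 0) : ∃ R : ℕ → H →L[ℝ] H, IsResolventSeq A R := by
  choose R hR using fun n : ℕ =>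
    exists_isResolventAt (lam := (n : ℝ) + 1) hA hr (by positivity)
  exact ⟨R, hA, dense_domain hA hr, hR⟩

/-- The Lumer–Phillips theorem in a Hilbert space. -/
theorem generatesQuasiContractive [CompleteSpace H] (hA : IsQuasiDissipative A ω)
    (hr : HasFullRange A ω) : GeneratesQuasiContractive A ω := by
  -- `A - ω` generates a contraction semigroup `T`; the semigroup of `A` is `exp (ω s) T s`.
  obtain ⟨R, hR⟩ := exists_isResolventSeq hA.shift hr.shift
  obtain ⟨T, hT⟩ := hR.exists_limit
  have hsg := hR.isC0Semigroup_limit hT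
  have hgen := hR.isGeneratorOf_limit hT
  have hexp : Tendsto (fun h : ℝ => Real.exp (ω * h)) (𝓝[>] 0) (𝓝 1) := by
    have : Continuous fun h : ℝ => Real.exp (ω * h) := by fun_prop
    simpa using (this.tendsto 0).mono_left nhdsWithin_le_nhds
  have hslope : Tendsto (fun h : ℝ => h⁻¹ * (Real.exp (ω * h) - 1)) (𝓝[>] 0) (𝓝 ω) := by
    have hd : HasDerivAt (fun h : ℝ => Real.exp (ω * h)) ω 0 := by
      simpa using ((hasDerivAt_id (0 : ℝ)).const_mul ω).exp
    simpa using hd.tendsto_slope_zero_right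
  have hsplit : ∀ (x : H) (h : ℝ), h⁻¹ • (Real.exp (ω * h) • T h x - x) =
      Real.exp (ω * h) • (h⁻¹ • (T h x - x)) + (h⁻¹ * (Real.exp (ω * h) - 1)) • x := by
    intro x h
    module
  refine ⟨fun s => Real.exp (ω * s) • T s, ⟨?_, ?_, ?_⟩, ?_, ?_⟩
  · simp [hsg.map_zero]
  · intro s t hs ht
    ext x
    simp [hsg.map_add s t hs ht, mul_add, Real.exp_add, smul_smul, mul_comm]
  · intro x
    simpa using hexp.smul (hsg.tendsto_zero x)
  · intro x y
    have h1 : (x, y) ∈ A.graph ↔ (x, y - ω • x) ∈ (shift A ω).graph := by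
      rw [LinearPMap.mem_graph_iff, LinearPMap.mem_graph_iff]
      constructor
      · rintro ⟨x', rfl, rfl⟩
        exact ⟨x', rfl, rfl⟩
      · rintro ⟨x', rfl, hx⟩
        refine ⟨x', rfl, ?_⟩
        change A x' - ω • (x' : H) = y - ω • (x' : H) at hx
        exact sub_left_injective hx
    rw [h1, hgen]
    simp only [smul_apply, hsplit]
    constructor
    · intro h
      simpa using (hexp.smul h).add (hslope.smul_const x)
    · intro h
      have h2 := (hexp.inv₀ one_ne_zero).smul (h.sub (hslope.smul_const x))
      rw [inv_one, one_smul] at h2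
      refine h2.congr fun t => ?_
      rw [add_sub_cancel_right, inv_smul_smul₀ (Real.exp_ne_zero _)]
  · intro s hs
    rw [norm_smul, Real.norm_eq_abs, abs_of_pos (Real.exp_pos _)]
    refine mul_le_of_le_one_right (Real.exp_pos _).le ?_
    refine ContinuousLinearMap.opNorm_le_bound _ zero_le_one fun x => ?_
    rw [one_mul]
    exact hR.norm_limit_apply_le hT hs x

theorem norm_prod_le_of_forall {K : ℝ} (hK : 0 ≤ K) (L : List (H →L[ℝ] H))
    (hL : ∀ R ∈ L, ‖R‖ ≤ K) : ‖L.prod‖ ≤ K ^ L.length := by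
  induction L with
  | nil =>
    rw [List.prod_nil, List.length_nil, pow_zero]
    exact ContinuousLinearMap.norm_id_le
  | cons R L ih =>
    rw [List.prod_cons, List.length_cons, pow_succ']
    exact (norm_mul_le _ _).trans (mul_le_mul (hL R (by simp))
      (ih fun S hS => hL S (by simp [hS])) (norm_nonneg _) hK)

/-- Each resolvent has norm at most `1 / (lam - ω)` in the one common norm, so submultiplicativity
bounds any product, in whatever order. -/
theorem isKatoStableWith [CompleteSpace H] {τ : ℝ} {A : Icc (0 : ℝ) τ → H →ₗ.[ℝ] H}
    (hA : ∀ t, IsQuasiDissipative (A t) ω) (hr : ∀ t, HasFullRange (A t) ω) :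
    IsKatoStableWith A 1 ω where
  one_le := le_rfl
  generates t := by
    obtain ⟨T, h1, h2, -⟩ := generatesQuasiContractive (hA t) (hr t)
    exact ⟨T, h1, h2⟩
  subset_resolventSet t lam hlam := exists_isResolventAt (hA t) (hr t) hlam
  norm_prod_le k t _ lam hlam := by
    have h0 : 0 < lam - ω := sub_pos.2 hlam
    have h := norm_prod_le_of_forall (K := 1 / (lam - ω)) (by positivity)
      ((List.ofFn fun j => resolvent (A (t j)) lam).reverse) (fun R hR => by
        rw [List.mem_reverse, List.mem_ofFn] at hR
        obtain ⟨j, rfl⟩ := hR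
        exact (resolvent_spec (exists_isResolventAt (hA (t j)) (hr (t j)) hlam)).norm_le
          (hA (t j)) hlam)
    rwa [List.length_reverse, List.length_ofFn, div_pow, one_pow] at h

/-! ### Coercive multiplicative perturbations -/

variable [CompleteSpace H]

/-- The equation is equivalent to the fixed-point equation `y = R(mu, A) (g + mu y - B y)`, and the
right-hand side is a strict contraction for large `mu`. -/
theorem exists_coercive_sub_eq (hA : IsQuasiDissipative A 0) (hr : HasFullRange A 0)
    {B : H →L[ℝ] H} {β : ℝ} (hβ : 0 < β) (hB : ∀ x, β * ‖x‖ ^ 2 ≤ inner ℝ (B x) x) (g : H) :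
    ∃ y : A.domain, B y - A y = g := by
  -- With `mu β = ‖B‖² + 1`, expanding the square gives `‖mu y - B y‖² ≤ (mu² - 2 mu β + ‖B‖²) ‖y‖²
  -- ≤ (mu² - mu β) ‖y‖²`. As `‖R(mu, A)‖ ≤ 1 / mu`, the contraction constant is `q < 1`.
  set mu : ℝ := (‖B‖ ^ 2 + 1) / β with hmu
  have hmu0 : 0 < mu := by positivity
  have hmuβ : mu * β = ‖B‖ ^ 2 + 1 := div_mul_cancel₀ _ hβ.ne'
  obtain ⟨R, hR⟩ := exists_isResolventAt hA hr hmu0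
  set q : ℝ := √(mu ^ 2 - mu * β) / mu with hq
  have hq0 : 0 ≤ q := by positivity
  have hq1 : q < 1 := by
    rw [div_lt_one hmu0, Real.sqrt_lt' hmu0]
    have := mul_pos hmu0 hβ
    linarith
  have hbound : ∀ y : H, ‖mu • y - B y‖ ≤ √(mu ^ 2 - mu * β) * ‖y‖ := by
    intro y
    have hBy : ‖B y‖ ^ 2 ≤ ‖B‖ ^ 2 * ‖y‖ ^ 2 := by
      rw [← mul_pow]
      exact pow_le_pow_left₀ (norm_nonneg _) (B.le_opNorm y) 2
    have h1 : ‖mu • y - B y‖ ^ 2 ≤ (mu ^ 2 - mu * β) * ‖y‖ ^ 2 := by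
      rw [norm_sub_sq_real, norm_smul, real_inner_smul_left, real_inner_comm, mul_pow,
        Real.norm_eq_abs, sq_abs]
      have h2 := mul_le_mul_of_nonneg_left (hB y) hmu0.le
      have h3 : mu * (β * ‖y‖ ^ 2) = (‖B‖ ^ 2 + 1) * ‖y‖ ^ 2 := by
        rw [← mul_assoc, hmuβ]
      nlinarith [sq_nonneg ‖y‖]
    rw [← Real.sqrt_sq (norm_nonneg (mu • y - B y)), ← Real.sqrt_sq (norm_nonneg y),
      ← Real.sqrt_mul' _ (sq_nonneg _)]
    exact Real.sqrt_le_sqrt h1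
  have hcontr : ContractingWith ⟨q, hq0⟩ (fun y => R (g + (mu • y - B y))) := by
    refine ⟨by exact_mod_cast hq1, LipschitzWith.of_dist_le_mul fun x y => ?_⟩
    rw [dist_eq_norm, dist_eq_norm, ← map_sub]
    have e : g + (mu • x - B x) - (g + (mu • y - B y)) = mu • (x - y) - B (x - y) := by
      rw [smul_sub, map_sub]
      abel
    have h1 := hR.norm_apply_le hA (mu • (x - y) - B (x - y))
    have h2 := hbound (x - y)
    rw [e]
    change _ ≤ q * _
    rw [hq, div_mul_eq_mul_div, le_div_iff₀ hmu0]
    linarith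
  set y := ContractingWith.fixedPoint _ hcontr
  have hy : R (g + (mu • y - B y)) = y := hcontr.fixedPoint_isFixedPt
  obtain ⟨h, e⟩ := hR.1 (g + (mu • y - B y))
  have hyd : y ∈ A.domain := hy ▸ h
  refine ⟨⟨y, hyd⟩, ?_⟩
  have e2 : mu • y - A ⟨y, hyd⟩ = g + (mu • y - B y) := by
    rw [← e]
    simp only [hy]
  change B y - A ⟨y, hyd⟩ = g
  have e3 : A ⟨y, hyd⟩ = mu • y - (g + (mu • y - B y)) := by rw [← e2]; abel
  rw [e3]
  abel

/-- In the variable `y = T x` the equation becomes `lam T⁻¹ y - A y = g`. Lax–Milgram inverts `T`,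
and `T⁻¹` is again coercive, with constant `m / (‖T‖² + 1)`. This allows `A T` to be treated without
any dissipativity of `A T` itself. -/
theorem exists_sub_comp_coercive_eq (hA : IsQuasiDissipative A 0) (hr : HasFullRange A 0)
    {T : H →L[ℝ] H} {m : ℝ} (hm : 0 < m) (hT : ∀ x, m * ‖x‖ ^ 2 ≤ inner ℝ (T x) x)
    {lam : ℝ} (hlam : 0 < lam) (g : H) :
    ∃ (x : H) (h : T x ∈ A.domain), lam • x - A ⟨T x, h⟩ = g := by
  have hco : IsCoercive ((innerSL ℝ).comp T) := by
    refine ⟨m, hm, fun u => ?_⟩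
    have := hT u
    rw [sq, ← mul_assoc] at this
    exact this
  set e := hco.continuousLinearEquivOfBilin
  have he : ∀ x, e x = T x := by
    intro x
    refine ext_inner_right ℝ fun w => ?_
    rw [hco.continuousLinearEquivOfBilin_apply]
    rfl
  have hC : 0 < ‖T‖ ^ 2 + 1 := by positivity
  have hB : ∀ y, lam * (m / (‖T‖ ^ 2 + 1)) * ‖y‖ ^ 2 ≤
      inner ℝ ((lam • (e.symm : H →L[ℝ] H)) y) y := by
    intro y
    have h1 := hT (e.symm y)
    rw [← he, ContinuousLinearEquiv.apply_symm_apply, real_inner_comm] at h1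
    have h2 : ‖y‖ ^ 2 ≤ (‖T‖ ^ 2 + 1) * ‖e.symm y‖ ^ 2 := by
      have h3 := T.le_opNorm (e.symm y)
      rw [← he, ContinuousLinearEquiv.apply_symm_apply] at h3
      have h4 := pow_le_pow_left₀ (norm_nonneg _) h3 2
      rw [mul_pow] at h4
      nlinarith [sq_nonneg ‖e.symm y‖]
    change _ ≤ inner ℝ (lam • e.symm y) y
    rw [real_inner_smul_left, mul_assoc]
    refine mul_le_mul_of_nonneg_left (le_trans ?_ h1) hlam.le
    rw [div_mul_eq_mul_div, div_le_iff₀ hC, mul_assoc, mul_comm _ (‖T‖ ^ 2 + 1)]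
    exact mul_le_mul_of_nonneg_left h2 hm.le
  obtain ⟨y, hy⟩ := exists_coercive_sub_eq hA hr (by positivity) hB g
  have hTy : T (e.symm y) = y := by rw [← he, ContinuousLinearEquiv.apply_symm_apply]
  refine ⟨e.symm y, by rw [hTy]; exact y.2, ?_⟩
  rw [← hy]
  simp only [hTy]
  rfl

end Hilbert

end Evolution

/-! ### Calculus in `H¹` of an interval -/

namespace Interval

variable {α β : ℝ} {f g u u' v v' : ℝ → ℝ}

theorem absolutelyContinuousOnInterval_congr (hu : AbsolutelyContinuousOnInterval u α β)
    (h : EqOn u u' (uIcc α β)) : AbsolutelyContinuousOnInterval u' α β := by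
  refine Tendsto.congr' ?_ hu
  filter_upwards [mem_inf_of_right (mem_principal_self _)] with E hE
  refine Finset.sum_congr rfl fun i hi => ?_
  rw [h (hE.1 i hi).1, h (hE.1 i hi).2]

theorem absolutelyContinuousOnInterval_const (c : ℝ) :
    AbsolutelyContinuousOnInterval (fun _ => c) α β :=
  contDiffOn_const.absolutelyContinuousOnInterval

theorem IsH1Rep.absolutelyContinuous (hf : IsH1Rep α β f u v) (hab : α ≤ β) :
    AbsolutelyContinuousOnInterval u α β := by
  have h1 := (hf.intervalIntegrable
    (right_mem_Icc.2 hab)).absolutelyContinuousOnInterval_intervalIntegral left_mem_uIcc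
  refine absolutelyContinuousOnInterval_congr
    ((absolutelyContinuousOnInterval_const (u α)).add h1) fun z hz => ?_
  rw [uIcc_of_le hab] at hz
  exact (hf.eq_integral z hz).symm

theorem IsH1Rep.ae_hasDerivAt (hf : IsH1Rep α β f u v) :
    ∀ᵐ z, z ∈ Ioo α β → HasDerivAt u (v z) z := by
  rcases le_or_gt α β with hab | hab
  · have hi := hf.intervalIntegrable (right_mem_Icc.2 hab)
    filter_upwards [hi.ae_hasDerivAt_integral] with z hz hzm
    have hzI : z ∈ uIcc α β := by rw [uIcc_of_le hab]; exact Ioo_subset_Icc_self hzm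
    refine ((hz hzI α left_mem_uIcc).const_add (u α)).congr_of_eventuallyEq ?_
    filter_upwards [Ioo_mem_nhds hzm.1 hzm.2] with y hy
    exact hf.eq_integral y (Ioo_subset_Icc_self hy)
  · simp [Ioo_eq_empty hab.not_gt]

theorem isH1Rep_of_absolutelyContinuous (hu : AbsolutelyContinuousOnInterval u α β)
    (hv : MemLp v 2 (volume.restrict (Icc α β)))
    (hd : ∀ᵐ z, z ∈ Ioo α β → HasDerivAt u (v z) z)
    (hf : f =ᵐ[volume.restrict (Icc α β)] u) : IsH1Rep α β f u v where
  ae_eq := hf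
  memLp := hv
  eq_integral z hz := by
    have hsub : uIcc α z ⊆ uIcc α β := by
      rw [uIcc_of_le hz.1, uIcc_of_le (hz.1.trans hz.2)]
      exact Icc_subset_Icc_right hz.2
    have h1 := (hu.mono hsub).integral_deriv_eq_sub
    have h2 : ∫ s in α..z, deriv u s = ∫ s in α..z, v s := by
      refine intervalIntegral.integral_congr_ae ?_
      have hne : ∀ᵐ s : ℝ, s ≠ β := by simp [ae_iff, measure_singleton]
      filter_upwards [hd, hne] with s hs hsb hsz
      rw [uIoc_of_le hz.1] at hsz
      exact (hs ⟨hsz.1, lt_of_le_of_ne (hsz.2.trans hz.2) hsb⟩).deriv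
    rw [← h2, h1]
    ring

theorem isH1Rep_of_hasDerivAt (hu : ∀ z, HasDerivAt u (v z) z) (hv : Continuous v)
    (hf : f =ᵐ[volume.restrict (Icc α β)] u) : IsH1Rep α β f u v where
  ae_eq := hf
  memLp := by
    have hc : IsCompact (Icc α β) := isCompact_Icc
    obtain ⟨C, hC⟩ := hc.exists_bound_of_continuousOn hv.continuousOn
    refine MemLp.of_bound hv.aestronglyMeasurable C ?_
    filter_upwards [ae_restrict_mem measurableSet_Icc] with z hz using hC z hz
  eq_integral z _ := by
    rw [intervalIntegral.integral_eq_sub_of_hasDerivAt (fun s _ => hu s)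
      (hv.intervalIntegrable _ _)]
    ring

/-- Integration by parts of a product of two `H¹` functions against a Lipschitz weight. -/
theorem abs_integral_weight_mul_sub_le {K : NNReal} {φ : ℝ → ℝ} (hab : α ≤ β)
    (hφ : LipschitzOnWith K φ (Icc α β)) (hf : IsH1Rep α β f u v) (hg : IsH1Rep α β g u' v') :
    |(∫ z in α..β, φ z * (v z * u' z + u z * v' z)) -
      (φ β * (u β * u' β) - φ α * (u α * u' α))| ≤ K * ∫ z in α..β, |u z * u' z| := by
  have hφac : AbsolutelyContinuousOnInterval φ α β := by
    rw [← uIcc_of_le hab] at hφ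
    exact hφ.absolutelyContinuousOnInterval
  have hw := (hf.absolutelyContinuous hab).mul (hg.absolutelyContinuous hab)
  -- After integration by parts the remainder is the integral of `φ'` against the product, and `|φ'|
  -- ≤ K` at interior points.
  have h1 := hφac.integral_mul_deriv_eq_deriv_mul hw
  have hne : ∀ᵐ s : ℝ, s ≠ β := by simp [ae_iff, measure_singleton]
  have h2 : ∫ z in α..β, φ z * deriv (u * u') z =
      ∫ z in α..β, φ z * (v z * u' z + u z * v' z) := by
    refine intervalIntegral.integral_congr_ae ?_
    filter_upwards [hf.ae_hasDerivAt, hg.ae_hasDerivAt, hne] with s h3 h4 hsb hs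
    rw [uIoc_of_le hab] at hs
    have hs' : s ∈ Ioo α β := ⟨hs.1, lt_of_le_of_ne hs.2 hsb⟩
    rw [((h3 hs').mul (h4 hs')).deriv]
  rw [← h2, h1]
  simp only [Pi.mul_apply]
  rw [sub_sub_cancel_left, abs_neg, ← intervalIntegral.integral_const_mul, ← Real.norm_eq_abs]
  refine intervalIntegral.norm_integral_le_of_norm_le hab ?_ ?_
  · filter_upwards [hne] with s hsb hs
    have hs' : s ∈ Ioo α β := ⟨hs.1, lt_of_le_of_ne hs.2 hsb⟩
    have h5 := norm_deriv_le_of_lipschitzOn (Icc_mem_nhds hs'.1 hs'.2) hφ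
    rw [norm_mul, ← Real.norm_eq_abs]
    exact mul_le_mul_of_nonneg_right h5 (norm_nonneg _)
  · refine ContinuousOn.intervalIntegrable ?_
    exact continuousOn_const.mul hw.continuousOn.abs

/-- The linear equation `p' = h - μ p` has an `H¹` solution vanishing at `l`. -/
theorem exists_isH1Rep_linear {h : ℝ → ℝ} {l : ℝ} (hl : l ∈ Icc α β)
    (hh : MemLp h 2 (volume.restrict (Icc α β))) (μ : ℝ) :
    ∃ p : ℝ → ℝ, p l = 0 ∧ IsH1Rep α β p p (fun z => h z - μ * p z) := by
  have hab : α ≤ β := hl.1.trans hl.2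
  have hexp : ∀ c : ℝ, ContDiff ℝ 1 fun z => Real.exp (c * z) := fun c => by fun_prop
  have hi : IntervalIntegrable (fun z => Real.exp (μ * z) * h z) volume α β := by
    have h1 : IntervalIntegrable h volume α β := by
      rw [intervalIntegrable_iff_integrableOn_Icc_of_le hab]
      exact hh.integrable (by norm_num)
    exact h1.continuousOn_mul (hexp μ).continuous.continuousOn
  -- Variation of constants based at `l`, which makes the solution vanish there.
  set p : ℝ → ℝ := fun z => Real.exp (-μ * z) * ∫ s in l..z, Real.exp (μ * s) * h s with hp
  have hlu : l ∈ uIcc α β := by rwa [uIcc_of_le hab]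
  have hac : AbsolutelyContinuousOnInterval p α β :=
    ((hexp (-μ)).contDiffOn.absolutelyContinuousOnInterval).mul
      (hi.absolutelyContinuousOnInterval_intervalIntegral hlu)
  refine ⟨p, by simp [hp], isH1Rep_of_absolutelyContinuous hac ?_ ?_ (ae_eq_refl _)⟩
  · have hpc : ContinuousOn p (Icc α β) := by
      rw [← uIcc_of_le hab]
      exact hac.continuousOn
    obtain ⟨C, hC⟩ := isCompact_Icc.exists_bound_of_continuousOn hpc
    refine hh.sub (MemLp.const_mul (MemLp.of_bound
      (hpc.aestronglyMeasurable measurableSet_Icc) C ?_) μ)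
    filter_upwards [ae_restrict_mem measurableSet_Icc] with z hz using hC z hz
  · filter_upwards [hi.ae_hasDerivAt_integral] with z hz hzm
    have hzI : z ∈ uIcc α β := by rw [uIcc_of_le hab]; exact Ioo_subset_Icc_self hzm
    have h1 := hz hzI l hlu
    have h2 : HasDerivAt (fun z => Real.exp (-μ * z)) (Real.exp (-μ * z) * (-μ)) z := by
      simpa using ((hasDerivAt_id z).const_mul (-μ)).exp
    have h3 := h2.mul h1
    have e : Real.exp (-μ * z) * (-μ) * (∫ s in l..z, Real.exp (μ * s) * h s) +
        Real.exp (-μ * z) * (Real.exp (μ * z) * h z) = h z - μ * p z := by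
      rw [← mul_assoc, ← Real.exp_add, neg_mul, neg_add_cancel, Real.exp_zero, hp]
      simp only [neg_mul]
      ring
    rw [e] at h3
    exact h3

theorem contRep_eq {z : ℝ} (hf : IsH1Rep α β f u v) (hab : α < β) (hz : z ∈ Icc α β) :
    contRep α β f z = u z :=
  (MemH1.isH1Rep ⟨u, v, hf⟩).eqOn hf hab hz

theorem weakDeriv_ae_eq (hf : IsH1Rep α β f u v) :
    weakDeriv α β f =ᵐ[volume.restrict (Icc α β)] v :=
  (MemH1.isH1Rep ⟨u, v, hf⟩).deriv_ae_eq hf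

theorem IsH1Rep.congr_ae (hf : IsH1Rep α β f u v) (h : g =ᵐ[volume.restrict (Icc α β)] f) :
    IsH1Rep α β g u v where
  ae_eq := h.trans hf.ae_eq
  memLp := hf.memLp
  eq_integral := hf.eq_integral

theorem IsH1Rep.mono (hf : IsH1Rep α β f u v) {α' β' : ℝ} (hα : α ≤ α') (hαβ : α' ≤ β')
    (hβ : β' ≤ β) :
    IsH1Rep α' β' f u v where
  ae_eq := ae_restrict_of_ae_restrict_of_subset (Icc_subset_Icc hα hβ) hf.ae_eq
  memLp := hf.memLp.mono_measure (Measure.restrict_mono (Icc_subset_Icc hα hβ) le_rfl)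
  eq_integral z hz := by
    have hα' : α' ∈ Icc α β := ⟨hα, hαβ.trans hβ⟩
    have hz' : z ∈ Icc α β := ⟨hα.trans hz.1, hz.2.trans hβ⟩
    rw [hf.eq_integral z hz', hf.eq_integral α' hα', add_assoc,
      intervalIntegral.integral_add_adjacent_intervals (hf.intervalIntegrable hα')
        ((hf.intervalIntegrable hα').symm.trans (hf.intervalIntegrable hz'))]

/-- Gluing of two `H¹` functions agreeing at an interior point. -/
theorem isH1Rep_ite {l : ℝ} (hl : l ∈ Icc α β) (hf : IsH1Rep α l u u v)
    (hg : IsH1Rep l β u' u' v') (h : u l = u' l) :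
    IsH1Rep α β (fun z => if z < l then u z else u' z) (fun z => if z < l then u z else u' z)
      (fun z => if z < l then v z else v' z) where
  ae_eq := ae_eq_refl _
  memLp := by
    have e : (fun z => if z < l then v z else v' z) =
        fun z => (Iio l).indicator v z + (Ici l).indicator v' z := by
      funext z
      by_cases hz : z < l
      · simp [hz]
      · simp [hz, not_lt.1 hz]
    rw [e]
    refine MemLp.add ?_ ?_
    · rw [memLp_indicator_iff_restrict measurableSet_Iio,
        Measure.restrict_restrict measurableSet_Iio]
      have hsub : Iio l ∩ Icc α β ⊆ Icc α l := fun z hz => ⟨hz.2.1, le_of_lt hz.1⟩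
      exact hf.memLp.mono_measure (Measure.restrict_mono hsub le_rfl)
    · rw [memLp_indicator_iff_restrict measurableSet_Ici,
        Measure.restrict_restrict measurableSet_Ici]
      have hsub : Ici l ∩ Icc α β ⊆ Icc l β := fun z hz => ⟨hz.1, hz.2.2⟩
      exact hg.memLp.mono_measure (Measure.restrict_mono hsub le_rfl)
  eq_integral := by
    have hne : ∀ᵐ s : ℝ, s ≠ l := by simp [ae_iff, measure_singleton]
    have h1 : ∀ z, z ≤ l → α ≤ z →
        ∫ s in α..z, (if s < l then v s else v' s) = ∫ s in α..z, v s := by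
      intro z hz hz'
      refine intervalIntegral.integral_congr_ae ?_
      filter_upwards [hne] with s hs hsz
      rw [uIoc_of_le hz'] at hsz
      exact if_pos (lt_of_le_of_ne (hsz.2.trans hz) hs)
    have hu : ∀ z, α ≤ z → z ≤ l → (if z < l then u z else u' z) = u z := by
      intro z _ hz
      rcases hz.eq_or_lt with rfl | hz
      · simp [h]
      · simp [hz]
    intro z hz
    simp only [hu α le_rfl hl.1]
    rcases le_or_gt z l with hzl | hzl
    · rw [hu z hz.1 hzl, h1 z hzl hz.1]
      exact hf.eq_integral z ⟨hz.1, hzl⟩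
    · have h2 : ∀ s ∈ uIcc l z, (if s < l then v s else v' s) = v' s := by
        intro s hs
        rw [uIcc_of_le hzl.le] at hs
        exact if_neg (not_lt.2 hs.1)
      have h3 : IntervalIntegrable (fun s => if s < l then v s else v' s) volume α l := by
        refine (hf.intervalIntegrable (right_mem_Icc.2 hl.1)).congr_ae ?_
        rw [EventuallyEq, ae_restrict_iff' measurableSet_uIoc]
        filter_upwards [hne] with s hs hsz
        rw [uIoc_of_le hl.1] at hsz
        exact (if_pos (lt_of_le_of_ne hsz.2 hs)).symm
      have hzI : z ∈ Icc l β := ⟨hzl.le, hz.2⟩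
      have h4 : IntervalIntegrable (fun s => if s < l then v s else v' s) volume l z :=
        (hg.intervalIntegrable hzI).congr
          (fun s hs => (h2 s (uIoc_subset_uIcc hs)).symm)
      rw [if_neg hzl.not_gt, hg.eq_integral z hzI, ← h, hf.eq_integral l (right_mem_Icc.2 hl.1),
        ← intervalIntegral.integral_add_adjacent_intervals h3 h4, h1 l le_rfl hl.1,
        intervalIntegral.integral_congr h2, add_assoc]

end Interval

/-! ### The operator `J_l` in terms of representatives -/

namespace InterfaceSystem

open Interval

variable (S : InterfaceSystem)

theorem coeFn_comp (i : Fin 2) (y : S.X) : S.comp i y =ᵐ[S.μ] fun z => (y z).ofLp i :=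
  ContinuousLinearMap.coeFn_compLpL _ y

theorem coeFn_incl (i : Fin 2) (f : S.L2) :
    S.incl i f =ᵐ[S.μ] fun z => f z • EuclideanSpace.single i (1 : ℝ) :=
  ContinuousLinearMap.coeFn_compLpL _ f

/-- Representatives and weak derivatives of the components of `y ∈ D(J_l)`. -/
structure IsJRep (l : S.Position) (y : S.X) (uL vL uR vR w dw : ℝ → ℝ) : Prop where
  left : IsH1Rep S.a l (S.comp 0 y) uL vL
  right : IsH1Rep l S.b (S.comp 0 y) uR vR
  second : IsH1Rep S.a S.b (S.comp 1 y) w dw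

variable {S} {l : S.Position} {y : S.X} {uL vL uR vR w dw : ℝ → ℝ}

theorem exists_isJRep (hy : y ∈ (S.J l).domain) :
    ∃ uL vL uR vR w dw, S.IsJRep l y uL vL uR vR w dw :=
  ⟨_, _, _, _, _, _, hy.1.1.isH1Rep, hy.1.2.isH1Rep, MemH1.isH1Rep hy.2⟩

namespace IsJRep

theorem mem_domain (h : S.IsJRep l y uL vL uR vR w dw) : y ∈ (S.J l).domain :=
  ⟨⟨⟨_, _, h.left⟩, ⟨_, _, h.right⟩⟩, ⟨_, _, h.second⟩⟩

theorem valueA_eq (h : S.IsJRep l y uL vL uR vR w dw) : S.valueA l y = ![uL S.a, w S.a] := by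
  rw [valueA, contRep_eq h.left l.2.1 (left_mem_Icc.2 l.2.1.le),
    contRep_eq h.second (S.a_neg.trans S.b_pos) (left_mem_Icc.2 (S.a_neg.trans S.b_pos).le)]

theorem valueB_eq (h : S.IsJRep l y uL vL uR vR w dw) : S.valueB l y = ![uR S.b, w S.b] := by
  rw [valueB, contRep_eq h.right l.2.2 (right_mem_Icc.2 l.2.2.le),
    contRep_eq h.second (S.a_neg.trans S.b_pos) (right_mem_Icc.2 (S.a_neg.trans S.b_pos).le)]

theorem interfaceFlow_eq (h : S.IsJRep l y uL vL uR vR w dw) : S.interfaceFlow l y = w l := by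
  rw [interfaceFlow, contRep_eq h.second (S.a_neg.trans S.b_pos) ⟨l.2.1.le, l.2.2.le⟩]

theorem coeFn_J (h : S.IsJRep l y uL vL uR vR w dw) :
    ∀ᵐ z ∂S.μ, (S.J l ⟨y, h.mem_domain⟩ z).ofLp 0 = -dw z ∧
      (z < l → (S.J l ⟨y, h.mem_domain⟩ z).ofLp 1 = -vL z) ∧
      ((l : ℝ) < z → (S.J l ⟨y, h.mem_domain⟩ z).ofLp 1 = -vR z) := by
  have hd := h.mem_domain
  have e : S.J l ⟨y, hd⟩ = S.incl 0 (S.dOp ⟨S.comp 1 y, hd.2⟩) -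
    S.incl 1 (S.dStarOp l ⟨S.comp 0 y, hd.1⟩) := rfl
  have hm : MemH1 S.a S.b (S.comp 1 y) := hd.2
  have h2 : S.dOp ⟨S.comp 1 y, hd.2⟩ =ᵐ[S.μ] fun z => -dw z := by
    change (⇑(-hm.isH1Rep.memLp.toLp (weakDeriv S.a S.b (S.comp 1 y)))) =ᵐ[S.μ] _
    filter_upwards [Lp.coeFn_neg (hm.isH1Rep.memLp.toLp (weakDeriv S.a S.b (S.comp 1 y))),
      hm.isH1Rep.memLp.coeFn_toLp,
      weakDeriv_ae_eq h.second] with z h1 h2 h3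
    rw [h1, Pi.neg_apply, h2, h3]
  have h1 := (S.memLp_dStar l hd.1).coeFn_toLp
  have hl := weakDeriv_ae_eq h.left
  have hr := weakDeriv_ae_eq h.right
  rw [EventuallyEq, ae_restrict_iff' measurableSet_Icc] at hl hr
  rw [e]
  filter_upwards [Lp.coeFn_sub (S.incl 0 (S.dOp ⟨S.comp 1 y, hd.2⟩))
    (S.incl 1 (S.dStarOp l ⟨S.comp 0 y, hd.1⟩)), S.coeFn_incl 0 (S.dOp ⟨S.comp 1 y, hd.2⟩),
    S.coeFn_incl 1 (S.dStarOp l ⟨S.comp 0 y, hd.1⟩), h2, h1, ae_restrict_of_ae hl,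
    ae_restrict_of_ae hr, ae_restrict_mem measurableSet_Icc] with z k1 k2 k3 k4 k5 k6 k7 hz
  have k5' : S.dStarOp l ⟨S.comp 0 y, hd.1⟩ z = _ := k5
  rw [k1, Pi.sub_apply, k2, k3, k4, k5']
  refine ⟨by simp, fun hzl => ?_, fun hzl => ?_⟩
  · simp [colorMinus, colorPlus, hzl, hzl.not_gt, k6 ⟨hz.1, hzl.le⟩]
  · simp [colorMinus, colorPlus, hzl, hzl.not_gt, k7 ⟨hzl.le, hz.2⟩]

end IsJRep

/-! ### The energy balance with a piecewise Lipschitz weight -/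

theorem integral_split (l : S.Position) {F : ℝ → ℝ} (hF : Integrable F S.μ) :
    ∫ z, F z ∂S.μ = (∫ z in S.a..l, F z) + ∫ z in l..S.b, F z := by
  have hab := (S.a_neg.trans S.b_pos).le
  have hi : IntervalIntegrable F volume S.a S.b := by
    rw [intervalIntegrable_iff_integrableOn_Icc_of_le hab]
    exact hF
  have hl : (l : ℝ) ∈ uIcc S.a S.b := by
    rw [uIcc_of_le hab]
    exact ⟨l.2.1.le, l.2.2.le⟩
  rw [intervalIntegral.integral_add_adjacent_intervals
    (hi.mono_set (uIcc_subset_uIcc left_mem_uIcc hl))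
    (hi.mono_set (uIcc_subset_uIcc hl right_mem_uIcc)),
    intervalIntegral.integral_of_le hab, integral_Icc_eq_integral_Ioc]

theorem intervalIntegrable_left (l : S.Position) {F : ℝ → ℝ} (hF : Integrable F S.μ) :
    IntervalIntegrable F volume S.a l := by
  rw [intervalIntegrable_iff_integrableOn_Icc_of_le l.2.1.le]
  exact IntegrableOn.mono_set hF (Icc_subset_Icc_right l.2.2.le)

theorem intervalIntegrable_right (l : S.Position) {F : ℝ → ℝ} (hF : Integrable F S.μ) :
    IntervalIntegrable F volume l S.b := by
  rw [intervalIntegrable_iff_integrableOn_Icc_of_le l.2.2.le]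
  exact IntegrableOn.mono_set hF (Icc_subset_Icc_left l.2.1.le)

/-- The boundary power `-[y₁ y₂]_a^b`. -/
noncomputable def boundaryPower (l : S.Position) (y : S.X) : ℝ :=
  -(S.valueB l y 0 * S.valueB l y 1 - S.valueA l y 0 * S.valueA l y 1)

/-- The balance on one side of the interface: `F` stands for the power density `-φ (y₁ y₂)'` and `G`
for `|y|²`. The factor `1/2` comes from `2 |y₁ y₂| ≤ |y|²`. -/
theorem integral_piece_le {α β : ℝ} {c d u v u' v' φ F G : ℝ → ℝ} {K : NNReal} (hab : α ≤ β)
    (hf : IsH1Rep α β c u v) (hg : IsH1Rep α β d u' v') (hφ : LipschitzOnWith K φ (Icc α β))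
    (hF : ∀ᵐ z, z ∈ Ioo α β → F z = -(φ z * (v z * u' z + u z * v' z)))
    (hG : IntervalIntegrable G volume α β) (hG' : ∀ᵐ z, z ∈ Ioo α β → 2 * |u z * u' z| ≤ G z) :
    ∫ z in α..β, F z ≤ -(φ β * (u β * u' β) - φ α * (u α * u' α)) +
      K / 2 * ∫ z in α..β, G z := by
  have hne : ∀ᵐ s : ℝ, s ≠ β := by simp [ae_iff, measure_singleton]
  have h1 : ∫ z in α..β, F z = -∫ z in α..β, φ z * (v z * u' z + u z * v' z) := by
    rw [← intervalIntegral.integral_neg]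
    refine intervalIntegral.integral_congr_ae ?_
    filter_upwards [hF, hne] with z h2 h3 hz
    rw [uIoc_of_le hab] at hz
    exact h2 ⟨hz.1, lt_of_le_of_ne hz.2 h3⟩
  have h2 := abs_integral_weight_mul_sub_le hab hφ hf hg
  have h3 : ∫ z in α..β, |u z * u' z| ≤ ∫ z in α..β, 1 / 2 * G z := by
    refine intervalIntegral.integral_mono_ae_restrict hab ?_ (hG.const_mul _) ?_
    · have hu := (hf.continuousOn.mul hg.continuousOn).abs
      rw [← uIcc_of_le hab] at hu
      exact hu.intervalIntegrable
    · rw [← Measure.restrict_congr_set (Ioo_ae_eq_Icc (μ := volume) (a := α) (b := β))]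
      rw [EventuallyLE, ae_restrict_iff' measurableSet_Ioo]
      filter_upwards [hG'] with z hz hzm
      linarith [hz hzm]
  rw [intervalIntegral.integral_const_mul] at h3
  have h4 := mul_le_mul_of_nonneg_left h3 K.coe_nonneg
  have h5 := (abs_le.1 h2).1
  rw [h1]
  linarith

/-- The energy balance for `J_l` against a piecewise Lipschitz weight. -/
theorem inner_J_le (hy : y ∈ (S.J l).domain) (hI : S.interfaceFlow l y = 0) {φL φR : ℝ → ℝ}
    {K : NNReal} (hL : LipschitzOnWith K φL (Icc S.a (l : ℝ)))
    (hR : LipschitzOnWith K φR (Icc (l : ℝ) S.b))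
    (hLa : φL S.a = 1) (hRb : φR S.b = 1) (x : S.X)
    (hx : ∀ᵐ z : ℝ ∂S.μ, (z < l → x z = φL z • y z) ∧ ((l : ℝ) < z → x z = φR z • y z)) :
    inner ℝ (S.J l ⟨y, hy⟩) x ≤ S.boundaryPower l y + K / 2 * ‖y‖ ^ 2 := by
  obtain ⟨uL, vL, uR, vR, w, dw, h⟩ := exists_isJRep hy
  -- Both interface terms carry the factor `y₂(l)`. Its vanishing removes them, although `y₁` may
  -- jump and `φL l` may differ from `φR l`.
  have hwl : w l = 0 := by rw [← h.interfaceFlow_eq, hI]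
  have hiy := L2.integrable_inner (𝕜 := ℝ) y y
  rw [← real_inner_self_eq_norm_sq, L2.inner_def, L2.inner_def, S.integral_split l
    (L2.integrable_inner _ _), S.integral_split l hiy, boundaryPower, h.valueA_eq, h.valueB_eq]
  have hsub1 : ∀ z ∈ Ioo S.a (l : ℝ), z ∈ Icc S.a S.b := fun z hz =>
    ⟨hz.1.le, (hz.2.trans l.2.2).le⟩
  have hsub2 : ∀ z ∈ Ioo (l : ℝ) S.b, z ∈ Icc S.a S.b := fun z hz =>
    ⟨(l.2.1.trans hz.1).le, hz.2.le⟩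
  have hJ := h.coeFn_J
  have hc0 := S.coeFn_comp 0 y
  have hc1 := S.coeFn_comp 1 y
  have e0L := h.left.ae_eq
  have e0R := h.right.ae_eq
  have e1 := h.second.ae_eq
  rw [ae_restrict_iff' measurableSet_Icc] at hx hJ
  rw [EventuallyEq, ae_restrict_iff' measurableSet_Icc] at hc0 hc1 e0L e0R e1
  have hkey : ∀ p q : ℝ, 2 * |p * q| ≤ p * p + q * q := fun p q => by
    rw [abs_mul]
    nlinarith [sq_nonneg (|p| - |q|), abs_mul_abs_self p, abs_mul_abs_self q]
  have hpL := integral_piece_le (F := fun z => inner ℝ (S.J l ⟨y, hy⟩ z) (x z))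
    (G := fun z => inner ℝ (y z) (y z)) l.2.1.le h.left (h.second.mono le_rfl l.2.1.le l.2.2.le)
    hL ?_ (S.intervalIntegrable_left l hiy) ?_
  · have hpR := integral_piece_le (F := fun z => inner ℝ (S.J l ⟨y, hy⟩ z) (x z))
      (G := fun z => inner ℝ (y z) (y z)) l.2.2.le h.right
      (h.second.mono l.2.1.le l.2.2.le le_rfl) hR ?_ (S.intervalIntegrable_right l hiy) ?_
    · simp only [hwl, hLa, hRb, mul_zero, one_mul] at hpL hpR
      simp only [Matrix.cons_val_zero, Matrix.cons_val_one]
      linarith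
    · filter_upwards [hx, hJ, hc0, hc1, e0R, e1] with z k1 k2 k3 k4 k5 k6 hz
      have hz' := hsub2 z hz
      rw [(k1 hz').2 hz.1, ← k6 hz', ← k5 ⟨hz.1.le, hz.2.le⟩, k3 hz', k4 hz']
      simp only [PiLp.inner_apply, Fin.sum_univ_two, RCLike.inner_apply, conj_trivial,
        (k2 hz').1, (k2 hz').2.2 hz.1, PiLp.smul_apply, smul_eq_mul]
      ring
    · filter_upwards [hc0, hc1, e0R, e1] with z k3 k4 k5 k6 hz
      have hz' := hsub2 z hz
      rw [← k6 hz', ← k5 ⟨hz.1.le, hz.2.le⟩, k3 hz', k4 hz']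
      simp only [PiLp.inner_apply, Fin.sum_univ_two, RCLike.inner_apply, conj_trivial]
      exact hkey _ _
  · filter_upwards [hx, hJ, hc0, hc1, e0L, e1] with z k1 k2 k3 k4 k5 k6 hz
    have hz' := hsub1 z hz
    rw [(k1 hz').1 hz.2, ← k6 hz', ← k5 ⟨hz.1.le, hz.2.le⟩, k3 hz', k4 hz']
    simp only [PiLp.inner_apply, Fin.sum_univ_two, RCLike.inner_apply, conj_trivial,
      (k2 hz').1, (k2 hz').2.1 hz.2, PiLp.smul_apply, smul_eq_mul]
    ring
  · filter_upwards [hc0, hc1, e0L, e1] with z k3 k4 k5 k6 hz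
    have hz' := hsub1 z hz
    rw [← k6 hz', ← k5 ⟨hz.1.le, hz.2.le⟩, k3 hz', k4 hz']
    simp only [PiLp.inner_apply, Fin.sum_univ_two, RCLike.inner_apply, conj_trivial]
    exact hkey _ _

end InterfaceSystem

/-! ### Boundary conditions -/

theorem vecMul_injective_of_rank {W : Matrix (Fin 2) (Fin 2 ⊕ Fin 2) ℝ} (h : W.rank = 2)
    {t : Fin 2 → ℝ} (ht : Matrix.vecMul t W = 0) : t = 0 := by
  have h1 : Module.finrank ℝ (LinearMap.range (W.transpose).mulVecLin) = 2 :=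
    (Matrix.rank_transpose W).trans h
  have h2 := (W.transpose).mulVecLin.finrank_range_add_finrank_ker
  rw [Module.finrank_fin_fun] at h2
  have h3 : Module.finrank ℝ (LinearMap.ker (W.transpose).mulVecLin) = 0 := by omega
  have h4 := Submodule.finrank_eq_zero.1 h3
  have h5 : t ∈ LinearMap.ker (W.transpose).mulVecLin := by
    rw [LinearMap.mem_ker, Matrix.mulVecLin_apply, Matrix.mulVec_transpose, ht]
  rw [h4] at h5
  exact (Submodule.mem_bot ℝ).1 h5

/-- The boundary conditions are dissipative: `f_∂ · e_∂ ≤ 0` on the kernel of `W_B`. -/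
theorem BoundaryAssumption.flow_mul_effort_nonpos {r : ℝ} {W : Matrix (Fin 2) (Fin 2 ⊕ Fin 2) ℝ}
    (hW : BoundaryAssumption r W) {p : Fin 2 ⊕ Fin 2 → ℝ} (hp : Matrix.mulVec W p = 0) :
    p (.inl 0) * p (.inr 0) + p (.inl 1) * p (.inr 1) ≤ 0 := by
  -- Write `t W = (a, b)` in blocks. The assumption `W Σ Wᵀ ≥ 0` says `a · b ≥ 0` on the row space
  -- of `W`.
  have hpos : ∀ t : Fin 2 → ℝ, 0 ≤ Matrix.vecMul t W (.inl 0) * Matrix.vecMul t W (.inr 0) +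
      Matrix.vecMul t W (.inl 1) * Matrix.vecMul t W (.inr 1) := by
    intro t
    have h := hW.posSemidef.dotProduct_mulVec_nonneg t
    rw [star_trivial, ← Matrix.mulVec_mulVec, ← Matrix.mulVec_mulVec, Matrix.mulVec_transpose,
      Matrix.dotProduct_mulVec] at h
    generalize Matrix.vecMul t W = u at h ⊢
    simp [portSigma, Matrix.mulVec, dotProduct, Fintype.sum_sum_type, Fin.sum_univ_two,
      Matrix.one_apply] at h
    linarith
  -- The map `t ↦ a + b` is injective: `a = -b` forces `a · b = -|a|²`, hence `a = b = 0`, and full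
  -- rank gives `t = 0`. By dimension it is onto, so `t` can be chosen with `a + b = f + e`.
  let L : (Fin 2 → ℝ) →ₗ[ℝ] (Fin 2 → ℝ) :=
    { toFun := fun t i => Matrix.vecMul t W (.inl i) + Matrix.vecMul t W (.inr i)
      map_add' := fun s t => by
        ext i
        simp only [Matrix.add_vecMul, Pi.add_apply]
        ring
      map_smul' := fun c t => by
        ext i
        simp only [Matrix.smul_vecMul, Pi.smul_apply, smul_eq_mul, RingHom.id_apply]
        ring }
  have hLi : Function.Injective L := by
    rw [injective_iff_map_eq_zero]
    intro t ht
    refine vecMul_injective_of_rank hW.rank_eq ?_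
    have h0 : Matrix.vecMul t W (.inl 0) + Matrix.vecMul t W (.inr 0) = 0 := congrFun ht 0
    have h1 : Matrix.vecMul t W (.inl 1) + Matrix.vecMul t W (.inr 1) = 0 := congrFun ht 1
    have h2 := hpos t
    have e0 := eq_neg_of_add_eq_zero_right h0
    have e1 := eq_neg_of_add_eq_zero_right h1
    rw [e0, e1] at h2
    have z0 : Matrix.vecMul t W (.inl 0) = 0 := by
      rw [← sq_eq_zero_iff]
      nlinarith [sq_nonneg (Matrix.vecMul t W (.inl 0)), sq_nonneg (Matrix.vecMul t W (.inl 1))]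
    have z1 : Matrix.vecMul t W (.inl 1) = 0 := by
      rw [← sq_eq_zero_iff]
      nlinarith [sq_nonneg (Matrix.vecMul t W (.inl 0)), sq_nonneg (Matrix.vecMul t W (.inl 1))]
    ext i
    rcases i with i | i <;> fin_cases i
    · exact z0
    · exact z1
    · simpa [z0] using e0
    · simpa [z1] using e1
  obtain ⟨t, ht⟩ := (LinearMap.injective_iff_surjective.1 hLi)
    (fun i => p (.inl i) + p (.inr i))
  have h0 : Matrix.vecMul t W (.inl 0) + Matrix.vecMul t W (.inr 0) = p (.inl 0) + p (.inr 0) :=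
    congrFun ht 0
  have h1 : Matrix.vecMul t W (.inl 1) + Matrix.vecMul t W (.inr 1) = p (.inl 1) + p (.inr 1) :=
    congrFun ht 1
  have h2 := hpos t
  have h3 : dotProduct (Matrix.vecMul t W) p = 0 := by
    rw [← Matrix.dotProduct_mulVec, hp, dotProduct_zero]
  simp only [dotProduct, Fintype.sum_sum_type, Fin.sum_univ_two] at h3
  generalize Matrix.vecMul t W (.inl 0) = a0 at *
  generalize Matrix.vecMul t W (.inl 1) = a1 at *
  generalize Matrix.vecMul t W (.inr 0) = b0 at *
  generalize Matrix.vecMul t W (.inr 1) = b1 at *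
  generalize p (.inl 0) = f0 at *
  generalize p (.inl 1) = f1 at *
  generalize p (.inr 0) = e0 at *
  generalize p (.inr 1) = e1 at *
  -- Polarization of the orthogonality `a · f + b · e = 0` between the row space and the kernel.
  -- Positivity gives `|a - b| ≤ |a + b| = |f + e|`, and then `|(a - b) + (f - e)|² ≥ 0` yields `|f
  -- + e| ≤ |f - e|`, which is `f · e ≤ 0`.
  have k1 : (f0 + e0) ^ 2 + (f1 + e1) ^ 2 = -((a0 - b0) * (f0 - e0) + (a1 - b1) * (f1 - e1)) := by
    have e2 : (f0 + e0) ^ 2 + (f1 + e1) ^ 2 =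
        (a0 + b0) * (f0 + e0) + (a1 + b1) * (f1 + e1) := by rw [h0, h1]; ring
    rw [e2]
    linear_combination 2 * h3
  have k2 : (a0 - b0) ^ 2 + (a1 - b1) ^ 2 ≤ (f0 + e0) ^ 2 + (f1 + e1) ^ 2 := by
    rw [← h0, ← h1]
    linarith
  nlinarith [sq_nonneg ((a0 - b0) + (f0 - e0)), sq_nonneg ((a1 - b1) + (f1 - e1))]

namespace InterfaceSystem

open Interval Evolution

variable {S : InterfaceSystem} {l : S.Position} {r : ℝ} {W : Matrix (Fin 2) (Fin 2 ⊕ Fin 2) ℝ}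

/-- The port variables are scaled so that `f_∂ · e_∂` is exactly `-[y₁ y₂]_a^b`; the factors `1/√2`
and the form of `P₁` are what produce this identity. -/
theorem boundaryPower_nonpos (hW : BoundaryAssumption r W) {y : S.X}
    (hy : Matrix.mulVec W (S.boundaryPort l y) = 0) : S.boundaryPower l y ≤ 0 := by
  have h := hW.flow_mul_effort_nonpos hy
  have h2 : (1 / √2 : ℝ) * (1 / √2) = 1 / 2 := by
    rw [div_mul_div_comm, one_mul, Real.mul_self_sqrt (by norm_num)]
  simp only [boundaryPort, Sum.elim_inl, Sum.elim_inr, boundaryFlow, boundaryEffort, P₁,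
    Pi.smul_apply, smul_eq_mul, Matrix.mulVec, dotProduct, Fin.sum_univ_two, Pi.sub_apply,
    Pi.add_apply, Matrix.of_apply, Matrix.cons_val_zero, Matrix.cons_val_one] at h
  rw [boundaryPower]
  nlinarith [h, h2]

/-! ### The operator `J_l` with interface and boundary conditions -/

/-- The operator `J_l` restricted by the interface condition `f_I = 0` and the boundary
conditions. -/
noncomputable def Jbc (W : Matrix (Fin 2) (Fin 2 ⊕ Fin 2) ℝ) (l : S.Position) :
    S.X →ₗ.[ℝ] S.X :=
  (S.J l).domRestrict (combSubmodule
    (fun y => y ∈ (S.J l).domain ∧ S.interfaceFlow l y = 0 ∧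
      Matrix.mulVec W (S.boundaryPort l y) = 0)
    (by
      have h0 : (0 : S.X) ∈ (S.J l).domain := Submodule.zero_mem _
      have ht := S.trace_comb l h0 h0 0 0
      have hp := S.boundaryPort_comb l h0 h0 0 0
      simp only [zero_smul, zero_mul, add_zero] at ht hp
      exact ⟨h0, ht.2.2.1, by rw [hp, Matrix.mulVec_zero]⟩)
    (fun x y hx hy c d => by
      refine ⟨Submodule.add_mem _ (Submodule.smul_mem _ _ hx.1) (Submodule.smul_mem _ _ hy.1),
        ?_, ?_⟩
      · rw [(S.trace_comb l hx.1 hy.1 c d).2.2.1, hx.2.1, hy.2.1]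
        simp
      · rw [S.boundaryPort_comb l hx.1 hy.1, Matrix.mulVec_add, Matrix.mulVec_smul,
          Matrix.mulVec_smul, hx.2.2, hy.2.2]
        simp))

theorem mem_Jbc_domain {y : S.X} : y ∈ (Jbc W l).domain ↔ y ∈ (S.J l).domain ∧
    S.interfaceFlow l y = 0 ∧ Matrix.mulVec W (S.boundaryPort l y) = 0 :=
  ⟨fun h => h.1, fun h => ⟨h, h.1⟩⟩

theorem Jbc_apply {y : S.X} (hy : y ∈ (Jbc W l).domain) :
    Jbc W l ⟨y, hy⟩ = S.J l ⟨y, (mem_Jbc_domain.1 hy).1⟩ := rfl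

/-- The energy balance with constant weight 1 and Lipschitz constant 0: only the boundary power
remains. -/
theorem isQuasiDissipative_Jbc (hW : BoundaryAssumption r W) :
    IsQuasiDissipative (Jbc W l) 0 := by
  rintro ⟨y, hy⟩
  obtain ⟨h1, h2, h3⟩ := mem_Jbc_domain.1 hy
  have h := inner_J_le h1 h2 (φL := fun _ => 1) (φR := fun _ => 1) (K := 0)
    ((LipschitzWith.const 1).lipschitzOnWith) ((LipschitzWith.const 1).lipschitzOnWith) rfl rfl y
    (Eventually.of_forall fun z => ⟨fun _ => (one_smul _ _).symm, fun _ => (one_smul _ _).symm⟩)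
  have h4 := boundaryPower_nonpos hW h3
  rw [Jbc_apply hy]
  simp only [NNReal.coe_zero, zero_div, zero_mul, add_zero] at h ⊢
  exact h.trans h4

/-! ### Solvability of `mu y - J_l y = g` -/

theorem exists_isJRep_of_isH1Rep {uL vL uR vR w dw : ℝ → ℝ} (hL : IsH1Rep S.a l uL uL vL)
    (hR : IsH1Rep l S.b uR uR vR) (h2 : IsH1Rep S.a S.b w w dw) :
    ∃ y : S.X, S.IsJRep l y uL vL uR vR w dw := by
  have hmem : ∀ {α β : ℝ} {u v : ℝ → ℝ}, IsH1Rep α β u u v →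
      MemLp u 2 (volume.restrict (Icc α β)) := by
    intro α β u v h
    obtain ⟨C, hC⟩ := isCompact_Icc.exists_bound_of_continuousOn h.continuousOn
    refine MemLp.of_bound (h.continuousOn.aestronglyMeasurable measurableSet_Icc) C ?_
    filter_upwards [ae_restrict_mem measurableSet_Icc] with z hz using hC z hz
  set u : ℝ → ℝ := fun z => (Iio (l : ℝ)).indicator uL z + (Ioi (l : ℝ)).indicator uR z
  have hu : MemLp u 2 S.μ := by
    refine MemLp.add ?_ ?_
    · rw [memLp_indicator_iff_restrict measurableSet_Iio,
        Measure.restrict_restrict measurableSet_Iio]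
      have hsub : Iio (l : ℝ) ∩ Icc S.a S.b ⊆ Icc S.a (l : ℝ) :=
        fun z hz => ⟨hz.2.1, le_of_lt hz.1⟩
      exact (hmem hL).mono_measure (Measure.restrict_mono hsub le_rfl)
    · rw [memLp_indicator_iff_restrict measurableSet_Ioi,
        Measure.restrict_restrict measurableSet_Ioi]
      have hsub : Ioi (l : ℝ) ∩ Icc S.a S.b ⊆ Icc (l : ℝ) S.b :=
        fun z hz => ⟨le_of_lt hz.1, hz.2.2⟩
      exact (hmem hR).mono_measure (Measure.restrict_mono hsub le_rfl)
  have hw : MemLp w 2 S.μ := hmem h2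
  set y : S.X := S.incl 0 (hu.toLp u) + S.incl 1 (hw.toLp w)
  have hy : ∀ᵐ z ∂S.μ, (y z).ofLp 0 = u z ∧ (y z).ofLp 1 = w z := by
    filter_upwards [Lp.coeFn_add (S.incl 0 (hu.toLp u)) (S.incl 1 (hw.toLp w)),
      S.coeFn_incl 0 (hu.toLp u), S.coeFn_incl 1 (hw.toLp w), hu.coeFn_toLp, hw.coeFn_toLp]
      with z k1 k2 k3 k4 k5
    rw [k1, Pi.add_apply, k2, k3, k4, k5]
    simp
  have hc0 : S.comp 0 y =ᵐ[S.μ] u := by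
    filter_upwards [S.coeFn_comp 0 y, hy] with z k1 k2
    rw [k1, k2.1]
  have hc1 : S.comp 1 y =ᵐ[S.μ] w := by
    filter_upwards [S.coeFn_comp 1 y, hy] with z k1 k2
    rw [k1, k2.2]
  have hne : ∀ᵐ z : ℝ, z ≠ l := by simp [ae_iff, measure_singleton]
  refine ⟨y, hL.congr_ae ?_, hR.congr_ae ?_, h2.congr_ae hc1⟩
  · filter_upwards [S.ae_left l hc0, ae_restrict_of_ae hne, ae_restrict_mem measurableSet_Icc]
      with z k1 k2 hz
    have hzl : z < l := lt_of_le_of_ne hz.2 k2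
    simp [k1, u, hzl, hzl.not_gt]
  · filter_upwards [S.ae_right l hc0, ae_restrict_of_ae hne, ae_restrict_mem measurableSet_Icc]
      with z k1 k2 hz
    have hzl : (l : ℝ) < z := lt_of_le_of_ne hz.1 (Ne.symm k2)
    simp [k1, u, hzl, hzl.not_gt]

/-- Turns the operator equation into the ODE system `mu y₁ + y₂' = g₁`, `mu y₂ + y₁' = g₂` on each
side of `l`; the point `l` itself is null. -/
theorem IsJRep.smul_sub_J_eq {y : S.X} {uL vL uR vR w dw : ℝ → ℝ}
    (h : S.IsJRep l y uL vL uR vR w dw) {mu : ℝ} {g : S.X}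
    (hL : ∀ᵐ z : ℝ ∂S.μ, z < l → mu * uL z + dw z = (g z).ofLp 0 ∧ mu * w z + vL z = (g z).ofLp 1)
    (hR : ∀ᵐ z ∂S.μ, (l : ℝ) < z →
      mu * uR z + dw z = (g z).ofLp 0 ∧ mu * w z + vR z = (g z).ofLp 1) :
    mu • y - S.J l ⟨y, h.mem_domain⟩ = g := by
  have e0L := h.left.ae_eq
  have e0R := h.right.ae_eq
  rw [EventuallyEq, ae_restrict_iff' measurableSet_Icc] at e0L e0R
  have hne : ∀ᵐ z : ℝ, z ≠ l := by simp [ae_iff, measure_singleton]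
  refine Lp.ext ?_
  filter_upwards [Lp.coeFn_sub (mu • y) (S.J l ⟨y, h.mem_domain⟩), Lp.coeFn_smul mu y,
    h.coeFn_J, S.coeFn_comp 0 y, S.coeFn_comp 1 y, ae_restrict_of_ae e0L, ae_restrict_of_ae e0R,
    h.second.ae_eq, ae_restrict_of_ae hne, hL, hR, ae_restrict_mem measurableSet_Icc]
    with z k1 k2 k3 k4 k5 k6 k7 k8 k9 k10 k11 hz
  rw [k1, Pi.sub_apply, k2, Pi.smul_apply]
  rcases lt_or_gt_of_ne k9 with hzl | hzl
  · ext i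
    fin_cases i
    · simp [k3.1, ← k4, k6 ⟨hz.1, hzl.le⟩, ← (k10 hzl).1]
    · simp [k3.2.1 hzl, ← k5, k8, ← (k10 hzl).2]
  · ext i
    fin_cases i
    · simp [k3.1, ← k4, k7 ⟨hzl.le, hz.2⟩, ← (k11 hzl).1]
    · simp [k3.2.2 hzl, ← k5, k8, ← (k11 hzl).2]

/-- The system decouples in `p = y₁ + y₂` and `q = y₁ - y₂`: `p' = (g₁ + g₂) - mu p` and `q' = (g₂ -
g₁) + mu q`. Starting both at zero at `l` gives `y₂(l) = 0`. -/
theorem exists_particular (l : S.Position) (mu : ℝ) (g : S.X) :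
    ∃ (y : S.X) (hy : y ∈ (S.J l).domain), S.interfaceFlow l y = 0 ∧
      mu • y - S.J l ⟨y, hy⟩ = g := by
  have hl : (l : ℝ) ∈ Icc S.a S.b := ⟨l.2.1.le, l.2.2.le⟩
  have hg0 : MemLp (fun z => (g z).ofLp 0) 2 S.μ := (Lp.memLp g).eval_piLp 0
  have hg1 : MemLp (fun z => (g z).ofLp 1) 2 S.μ := (Lp.memLp g).eval_piLp 1
  obtain ⟨p, hp0, hp⟩ := exists_isH1Rep_linear hl (hg0.add hg1) mu
  obtain ⟨q, hq0, hq⟩ := exists_isH1Rep_linear hl (hg1.sub hg0) (-mu)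
  have h1 := hp.comb hq (1 / 2) (1 / 2) (ae_eq_refl _)
  have h2 := hp.comb hq (1 / 2) (-(1 / 2)) (ae_eq_refl _)
  obtain ⟨y, hy⟩ := exists_isJRep_of_isH1Rep (h1.mono le_rfl l.2.1.le l.2.2.le)
    (h1.mono l.2.1.le l.2.2.le le_rfl) h2
  refine ⟨y, hy.mem_domain, ?_, hy.smul_sub_J_eq ?_ ?_⟩
  · rw [hy.interfaceFlow_eq, hp0, hq0]
    ring
  all_goals
    refine Eventually.of_forall fun z _ => ⟨?_, ?_⟩ <;> simp only [Pi.add_apply, Pi.sub_apply] <;>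
      ring

/-- The solutions are `y₁ = c cosh (mu (z - l))`, `y₂ = -c sinh (mu (z - l))` to the left of `l`,
and the same with `d` to the right. As `sinh` vanishes at 0, `y₂` is continuous with `y₂(l) = 0`,
while the allowed jump of `y₁` keeps `c` and `d` independent. -/
theorem exists_homogeneous (l : S.Position) (mu c d : ℝ) :
    ∃ (y : S.X) (hy : y ∈ (S.J l).domain), S.interfaceFlow l y = 0 ∧
      mu • y - S.J l ⟨y, hy⟩ = 0 ∧ S.valueA l y 0 = c * Real.cosh (mu * (S.a - l)) ∧
      S.valueB l y 0 = d * Real.cosh (mu * (S.b - l)) := by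
  have hl : (l : ℝ) ∈ Icc S.a S.b := ⟨l.2.1.le, l.2.2.le⟩
  have hlin : ∀ z, HasDerivAt (fun z => mu * (z - l)) mu z := fun z => by
    simpa using ((hasDerivAt_id z).sub_const (l : ℝ)).const_mul mu
  have hcosh : ∀ (e z : ℝ), HasDerivAt (fun z => e * Real.cosh (mu * (z - l)))
      (e * (Real.sinh (mu * (z - l)) * mu)) z := fun e z => (hlin z).cosh.const_mul e
  have hsinh : ∀ (e z : ℝ), HasDerivAt (fun z => -(e * Real.sinh (mu * (z - l))))
      (-(e * (Real.cosh (mu * (z - l)) * mu))) z := fun e z => ((hlin z).sinh.const_mul e).neg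
  have hcc : ∀ e : ℝ, Continuous fun z => e * (Real.sinh (mu * (z - l)) * mu) := fun e => by
    fun_prop
  have hsc : ∀ e : ℝ, Continuous fun z => -(e * (Real.cosh (mu * (z - l)) * mu)) := fun e => by
    fun_prop
  have h2 : IsH1Rep S.a S.b (fun z => if z < l then -(c * Real.sinh (mu * (z - l)))
        else -(d * Real.sinh (mu * (z - l)))) (fun z => if z < l then
        -(c * Real.sinh (mu * (z - l))) else -(d * Real.sinh (mu * (z - l))))
      (fun z => if z < l then -(c * (Real.cosh (mu * (z - l)) * mu))
        else -(d * (Real.cosh (mu * (z - l)) * mu))) :=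
    isH1Rep_ite hl (isH1Rep_of_hasDerivAt (hsinh c) (hsc c) (ae_eq_refl _))
      (isH1Rep_of_hasDerivAt (hsinh d) (hsc d) (ae_eq_refl _)) (by simp)
  obtain ⟨y, hy⟩ := exists_isJRep_of_isH1Rep (l := l)
    (isH1Rep_of_hasDerivAt (hcosh c) (hcc c) (ae_eq_refl _))
    (isH1Rep_of_hasDerivAt (hcosh d) (hcc d) (ae_eq_refl _)) h2
  refine ⟨y, hy.mem_domain, ?_, hy.smul_sub_J_eq ?_ ?_, ?_, ?_⟩
  · rw [hy.interfaceFlow_eq]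
    simp
  · filter_upwards [Lp.coeFn_zero (EuclideanSpace ℝ (Fin 2)) 2 S.μ] with z k1 hz
    rw [k1]
    simp only [hz, if_true, Pi.zero_apply, PiLp.zero_apply]
    constructor <;> ring
  · filter_upwards [Lp.coeFn_zero (EuclideanSpace ℝ (Fin 2)) 2 S.μ] with z k1 hz
    rw [k1]
    simp only [hz.not_gt, if_false, Pi.zero_apply, PiLp.zero_apply]
    constructor <;> ring
  · rw [hy.valueA_eq]
    rfl
  · rw [hy.valueB_eq]
    rfl

/-- The two free constants of the homogeneous family must absorb the two boundary conditions. The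
resulting square linear system is solvable once it is injective, which dissipativity supplies. -/
theorem hasFullRange_Jbc (hW : BoundaryAssumption r W) : HasFullRange (Jbc W l) 0 := by
  intro mu hmu g
  obtain ⟨k₁, h₁, i₁, e₁, a₁, b₁⟩ := exists_homogeneous l mu 1 0
  obtain ⟨k₂, h₂, i₂, e₂, a₂, b₂⟩ := exists_homogeneous l mu 0 1
  obtain ⟨y, hy, iy, ey⟩ := exists_particular l mu g
  have hJ : ∀ c d : ℝ, ∃ h : c • k₁ + d • k₂ ∈ (S.J l).domain,
      mu • (c • k₁ + d • k₂) - S.J l ⟨c • k₁ + d • k₂, h⟩ = 0 := by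
    intro c d
    refine ⟨Submodule.add_mem _ (Submodule.smul_mem _ _ h₁) (Submodule.smul_mem _ _ h₂), ?_⟩
    have e : S.J l ⟨c • k₁ + d • k₂,
        Submodule.add_mem _ (Submodule.smul_mem _ _ h₁) (Submodule.smul_mem _ _ h₂)⟩ =
        c • S.J l ⟨k₁, h₁⟩ + d • S.J l ⟨k₂, h₂⟩ := by
      rw [← LinearPMap.map_smul, ← LinearPMap.map_smul, ← LinearPMap.map_add]
      rfl
    rw [e, ← sub_eq_zero.1 e₁, ← sub_eq_zero.1 e₂]
    module
  let G : (Fin 2 → ℝ) →ₗ[ℝ] (Fin 2 → ℝ) := combLinearMap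
    (fun c => c 0 • Matrix.mulVec W (S.boundaryPort l k₁) +
      c 1 • Matrix.mulVec W (S.boundaryPort l k₂))
    (fun x y c d => by
      simp only [Pi.add_apply, Pi.smul_apply, smul_eq_mul]
      module)
  have hG : ∀ c, G c = Matrix.mulVec W (S.boundaryPort l (c 0 • k₁ + c 1 • k₂)) := by
    intro c
    rw [S.boundaryPort_comb l h₁ h₂, Matrix.mulVec_add, Matrix.mulVec_smul, Matrix.mulVec_smul]
    rfl
  -- A homogeneous solution `k` meeting the boundary conditions satisfies `mu ‖k‖² = ⟨J k, k⟩ ≤ 0`,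
  -- so `k = 0`. Its traces `c cosh` at `a` and `d cosh` at `b` then vanish, and `cosh > 0`.
  have hinj : Function.Injective G := by
    rw [injective_iff_map_eq_zero]
    intro c hc
    rw [hG] at hc
    obtain ⟨hd, he⟩ := hJ (c 0) (c 1)
    have ht := S.trace_comb l h₁ h₂ (c 0) (c 1)
    have hdis := isQuasiDissipative_Jbc hW ⟨c 0 • k₁ + c 1 • k₂, mem_Jbc_domain.2
      ⟨hd, by rw [ht.2.2.1, i₁, i₂]; simp, hc⟩⟩
    rw [Jbc_apply, ← sub_eq_zero.1 he, real_inner_smul_left, real_inner_self_eq_norm_sq,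
      zero_mul] at hdis
    have hz : c 0 • k₁ + c 1 • k₂ = 0 := by
      rw [← norm_eq_zero, ← sq_eq_zero_iff]
      refine le_antisymm ?_ (sq_nonneg _)
      exact nonpos_of_mul_nonpos_right hdis hmu
    have h0 : (0 : S.X) ∈ (S.J l).domain := Submodule.zero_mem _
    have ht0 := S.trace_comb l h0 h0 0 0
    simp only [zero_smul, add_zero] at ht0
    rw [hz] at ht
    have hA := congrFun (ht0.1.symm.trans ht.1) 0
    have hB := congrFun (ht0.2.1.symm.trans ht.2.1) 0
    have p1 := Real.cosh_pos (mu * (S.a - l))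
    have p2 := Real.cosh_pos (mu * (S.b - l))
    simp only [Pi.zero_apply, Pi.add_apply, Pi.smul_apply, smul_eq_mul, a₁, a₂, b₁, b₂, zero_mul,
      mul_zero, add_zero, one_mul, zero_add] at hA hB
    ext i
    fin_cases i
    · exact (mul_eq_zero.1 hA.symm).resolve_right p1.ne'
    · exact (mul_eq_zero.1 hB.symm).resolve_right p2.ne'
  obtain ⟨c, hc⟩ := LinearMap.injective_iff_surjective.1 hinj
    (Matrix.mulVec W (S.boundaryPort l y))
  rw [hG] at hc
  obtain ⟨hd, he⟩ := hJ (c 0) (c 1)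
  set k := c 0 • k₁ + c 1 • k₂ with hk
  have ik : S.interfaceFlow l k = 0 := by
    rw [hk, (S.trace_comb l h₁ h₂ (c 0) (c 1)).2.2.1, i₁, i₂]
    simp
  have hmem : (1 : ℝ) • y + (-1 : ℝ) • k ∈ (Jbc W l).domain := by
    refine mem_Jbc_domain.2 ⟨Submodule.add_mem _ (Submodule.smul_mem _ _ hy)
      (Submodule.smul_mem _ _ hd), ?_, ?_⟩
    · rw [(S.trace_comb l hy hd 1 (-1)).2.2.1, iy, ik]
      simp
    · rw [S.boundaryPort_comb l hy hd, Matrix.mulVec_add, Matrix.mulVec_smul,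
        Matrix.mulVec_smul, hc]
      simp
  refine ⟨⟨_, hmem⟩, ?_⟩
  rw [Jbc_apply hmem]
  have e : S.J l ⟨(1 : ℝ) • y + (-1 : ℝ) • k, (mem_Jbc_domain.1 hmem).1⟩ =
      (1 : ℝ) • S.J l ⟨y, hy⟩ + (-1 : ℝ) • S.J l ⟨k, hd⟩ := by
    rw [← LinearPMap.map_smul, ← LinearPMap.map_smul, ← LinearPMap.map_add]
    rfl
  rw [e, ← sub_eq_zero.1 he, ← ey]
  module

end InterfaceSystem

/-! ### The port-Hamiltonian operator on the energy space -/

namespace InterfaceSystem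

open Interval Evolution

variable (S : InterfaceSystem)

/-- The entries are bounded by `M`, so each of the two rows contributes at most `2 M² |x|²` to the
squared norm. -/
theorem norm_mulQ_le (l : ℝ) (x : S.X) : ‖S.mulQ l x‖ ≤ 2 * S.M * ‖x‖ := by
  have hM : 0 < S.M := S.m_pos.trans_le S.m_le_M
  refine Lp.norm_le_mul_norm_of_ae_le_mul ?_
  filter_upwards [S.coeFn_mulQ l x, S.abs_Q_le l] with z h1 h2
  rw [h1, ← sq_le_sq₀ (norm_nonneg _) (by positivity), mul_pow, EuclideanSpace.norm_sq_eq,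
    EuclideanSpace.norm_sq_eq]
  simp only [Fin.sum_univ_two, Matrix.mulVec, dotProduct, Real.norm_eq_abs, sq_abs] at h2 ⊢
  have hb : ∀ p q s t : ℝ, |p| ≤ S.M → |q| ≤ S.M →
      (p * s + q * t) ^ 2 ≤ 2 * S.M ^ 2 * (s ^ 2 + t ^ 2) := by
    intro p q s t hp hq
    have hp2 : p ^ 2 ≤ S.M ^ 2 := sq_le_sq.2 (hp.trans (le_abs_self _))
    have hq2 : q ^ 2 ≤ S.M ^ 2 := sq_le_sq.2 (hq.trans (le_abs_self _))
    nlinarith [sq_nonneg (p * s - q * t), mul_le_mul_of_nonneg_right hp2 (sq_nonneg s),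
      mul_le_mul_of_nonneg_right hq2 (sq_nonneg t)]
  have e0 := hb _ _ ((x z).ofLp 0) ((x z).ofLp 1) (h2 0 0) (h2 0 1)
  have e1 := hb _ _ ((x z).ofLp 0) ((x z).ofLp 1) (h2 1 0) (h2 1 1)
  linarith

/-- The multiplication operator `Q_l` as a bounded operator. -/
noncomputable def mulQCLM (l : ℝ) : S.X →L[ℝ] S.X :=
  (S.mulQ l).mkContinuous (2 * S.M) (S.norm_mulQ_le l)

theorem energy_norm_sq (l : ℝ) (x : S.EnergySpace l) :
    ‖x‖ ^ 2 = 1 / 2 * inner ℝ (S.mulQ l (S.toX l x)) (S.toX l x) := by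
  rw [← real_inner_self_eq_norm_sq, energy_inner_def]

theorem le_energy_norm_sq (l : ℝ) (x : S.EnergySpace l) :
    S.m / 2 * ‖S.toX l x‖ ^ 2 ≤ ‖x‖ ^ 2 := by
  rw [energy_norm_sq]
  linarith [S.le_inner_mulQ l (S.toX l x)]

theorem energy_norm_sq_le (l : ℝ) (x : S.EnergySpace l) :
    ‖x‖ ^ 2 ≤ S.M * ‖S.toX l x‖ ^ 2 := by
  rw [energy_norm_sq]
  have h1 := real_inner_le_norm (S.mulQ l (S.toX l x)) (S.toX l x)
  have h2 := mul_le_mul_of_nonneg_right (S.norm_mulQ_le l (S.toX l x)) (norm_nonneg (S.toX l x))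
  nlinarith

/-- The identity map from the energy space to `X` is a linear homeomorphism. -/
noncomputable def toXL (l : ℝ) : S.EnergySpace l ≃L[ℝ] S.X :=
  LinearEquiv.toContinuousLinearEquivOfBounds (S.toX l) √(2 / S.m) √S.M
    (fun x => by
      have hm := S.m_pos
      have h := S.le_energy_norm_sq l x
      rw [← Real.sqrt_sq (norm_nonneg (S.toX l x)), ← Real.sqrt_sq (norm_nonneg x),
        ← Real.sqrt_mul' _ (sq_nonneg _)]
      refine Real.sqrt_le_sqrt ?_
      rw [div_mul_eq_mul_div, le_div_iff₀ hm]
      linarith)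
    (fun x => by
      have h := S.energy_norm_sq_le l ((S.toX l).symm x)
      rw [LinearEquiv.apply_symm_apply] at h
      rw [← Real.sqrt_sq (norm_nonneg ((S.toX l).symm x)), ← Real.sqrt_sq (norm_nonneg x),
        ← Real.sqrt_mul' _ (sq_nonneg _)]
      exact Real.sqrt_le_sqrt h)

instance (l : ℝ) : CompleteSpace (S.EnergySpace l) :=
  (completeSpace_congr (e := (S.toXL l).toEquiv) (S.toXL l).isUniformEmbedding).2 inferInstance

variable {S}

/-! ### The scalar weight relating `Q_0` to `Q_l` -/

namespace CoefficientAssumption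

/-- The standing bounds hold only almost everywhere; continuity of `min q m`, which equals `m`
almost everywhere, upgrades them to every point, so that the quotients are defined throughout. -/
theorem le_diag {q : ℝ → ℝ} (hq : ContinuousOn q (Icc S.a S.b)) (h : ∀ᵐ z ∂S.μ, S.m ≤ q z) :
    ∀ z ∈ Icc S.a S.b, S.m ≤ q z := by
  have h1 : (fun z => min (q z) S.m) =ᵐ[volume.restrict (Icc S.a S.b)] fun _ => S.m := by
    filter_upwards [h] with z hz using min_eq_right hz
  intro z hz
  have := Measure.eqOn_Icc_of_ae_eq volume (S.a_neg.trans S.b_pos).ne h1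
    (hq.inf continuousOn_const) continuousOn_const hz
  exact min_eq_right_iff.1 this

theorem le_Qm (hA : S.CoefficientAssumption) (i : Fin 2) {z : ℝ} (hz : z ∈ Icc S.a S.b) :
    S.m ≤ S.Qm z i i := by
  refine le_diag (hA.contDiffOn_Qm i i).continuousOn ?_ z hz
  filter_upwards [S.bounds_Qm] with y hy
  have h := (quad_bounds hy.1 hy.2).2
  have h0 := (h 1 0).1
  have h1 := (h 0 1).1
  fin_cases i
  · simpa using h0
  · simpa using h1

theorem le_Qp (hA : S.CoefficientAssumption) (i : Fin 2) {z : ℝ} (hz : z ∈ Icc S.a S.b) :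
    S.m ≤ S.Qp z i i := by
  refine le_diag (hA.contDiffOn_Qp i i).continuousOn ?_ z hz
  filter_upwards [S.bounds_Qp] with y hy
  have h := (quad_bounds hy.1 hy.2).2
  have h0 := (h 1 0).1
  have h1 := (h 0 1).1
  fin_cases i
  · simpa using h0
  · simpa using h1

/-- The quotient `q₁₁⁺ / q₁₁⁻` evaluated at `max z 0`: the ratio `Q_0 Q_l⁻¹` to the left of `l`. -/
noncomputable def weightL (S : InterfaceSystem) (z : ℝ) : ℝ :=
  S.Qp (max z 0) 0 0 / S.Qm (max z 0) 0 0

/-- The quotient `q₁₁⁻ / q₁₁⁺` evaluated at `min z 0`: the ratio `Q_0 Q_l⁻¹` to the right of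
`l`. -/
noncomputable def weightR (S : InterfaceSystem) (z : ℝ) : ℝ :=
  S.Qm (min z 0) 0 0 / S.Qp (min z 0) 0 0

theorem weightL_of_nonpos (hA : S.CoefficientAssumption) {z : ℝ} (hz : z ≤ 0) :
    weightL S z = 1 := by
  rw [weightL, max_eq_right hz, hA.ratio_zero]

theorem weightR_of_nonneg (hA : S.CoefficientAssumption) {z : ℝ} (hz : 0 ≤ z) :
    weightR S z = 1 := by
  rw [weightR, min_eq_right hz, ← inv_div, hA.ratio_zero, inv_one]

/-- The quotients are `C¹` on a compact interval, and truncating the argument at 0 is 1-Lipschitz.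
Neither weight involves `l`, hence one constant `K` serves all interface positions. -/
theorem exists_lipschitz_weights (hA : S.CoefficientAssumption) :
    ∃ K : NNReal, LipschitzOnWith K (weightL S) (Icc S.a S.b) ∧
      LipschitzOnWith K (weightR S) (Icc S.a S.b) := by
  have hm := fun z (hz : z ∈ Icc S.a S.b) => (S.m_pos.trans_le (hA.le_Qm 0 hz)).ne'
  have hp := fun z (hz : z ∈ Icc S.a S.b) => (S.m_pos.trans_le (hA.le_Qp 0 hz)).ne'
  obtain ⟨K₁, hK₁⟩ := ((hA.contDiffOn_Qp 0 0).div (hA.contDiffOn_Qm 0 0)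
    hm).exists_lipschitzOnWith one_ne_zero (convex_Icc _ _) isCompact_Icc
  obtain ⟨K₂, hK₂⟩ := ((hA.contDiffOn_Qm 0 0).div (hA.contDiffOn_Qp 0 0)
    hp).exists_lipschitzOnWith one_ne_zero (convex_Icc _ _) isCompact_Icc
  refine ⟨max K₁ K₂, ?_, ?_⟩
  · have h := hK₁.comp (f := fun z : ℝ => max z 0) (s := Icc S.a S.b)
      ((LipschitzWith.id.max_const 0).lipschitzOnWith)
      (fun z hz => ⟨hz.1.trans (le_max_left _ _), max_le hz.2 S.b_pos.le⟩)
    exact h.weaken (by simp)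
  · have h := hK₂.comp (f := fun z : ℝ => min z 0) (s := Icc S.a S.b)
      ((LipschitzWith.id.min_const 0).lipschitzOnWith)
      (fun z hz => ⟨le_min hz.1 S.a_neg.le, (min_le_left _ _).trans hz.2⟩)
    exact h.weaken (by simp)

/-- Equality of the two diagonal ratios makes the quotient of the matrices a scalar. Without it `Q_0
Q_l⁻¹` would weight the two components differently and the power density would not be a multiple of
`(y₁ y₂)'`. -/
theorem Qp_eq_smul (hA : S.CoefficientAssumption) {z : ℝ} (hz : z ∈ Icc S.a S.b) :
    S.Qp z = (S.Qp z 0 0 / S.Qm z 0 0) • S.Qm z := by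
  have h0 := (S.m_pos.trans_le (hA.le_Qm 0 hz)).ne'
  have h1 := (S.m_pos.trans_le (hA.le_Qm 1 hz)).ne'
  have d1 := hA.isDiag_Qm z hz
  have d2 := hA.isDiag_Qp z hz
  ext i j
  rw [Matrix.smul_apply, smul_eq_mul]
  by_cases hij : i = j
  · subst hij
    fin_cases i
    · exact (div_mul_cancel₀ _ h0).symm
    · change S.Qp z 1 1 = _ * S.Qm z 1 1
      rw [hA.ratio_eq z hz, div_mul_cancel₀ _ h1]
  · rw [d1 hij, d2 hij, mul_zero]

theorem Qm_eq_smul (hA : S.CoefficientAssumption) {z : ℝ} (hz : z ∈ Icc S.a S.b) :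
    S.Qm z = (S.Qm z 0 0 / S.Qp z 0 0) • S.Qp z := by
  have h0 := (S.m_pos.trans_le (hA.le_Qm 0 hz)).ne'
  have h1 := (S.m_pos.trans_le (hA.le_Qp 0 hz)).ne'
  rw [hA.Qp_eq_smul hz, smul_smul, Matrix.smul_apply, smul_eq_mul, div_mul_cancel₀ _ h0,
    div_mul_div_cancel₀ h1, div_self h0, one_smul]

/-- `Q_0` and `Q_l` differ only between 0 and `l`. Elsewhere the truncated argument is 0, where the
ratio is 1, so a single formula on each side of `l` covers both signs of `l`. -/
theorem mulQ_zero_eq (hA : S.CoefficientAssumption) (l : ℝ) (x : S.X) :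
    ∀ᵐ z : ℝ ∂S.μ, (z < l → S.mulQ 0 x z = weightL S z • S.mulQ l x z) ∧
      (l < z → S.mulQ 0 x z = weightR S z • S.mulQ l x z) := by
  have hne : ∀ᵐ z : ℝ, z ≠ 0 := by simp [ae_iff, measure_singleton]
  filter_upwards [S.coeFn_mulQ 0 x, S.coeFn_mulQ l x, ae_restrict_of_ae hne,
    ae_restrict_mem measurableSet_Icc] with z h1 h2 h3 hz
  have key : ∀ c : ℝ, S.Q 0 z = c • S.Q l z → S.mulQ 0 x z = c • S.mulQ l x z := by
    intro c hc
    rw [h1, h2, hc, Matrix.smul_mulVec, WithLp.toLp_smul]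
  refine ⟨fun hzl => key _ ?_, fun hzl => key _ ?_⟩
  · rcases lt_or_gt_of_ne h3 with h0 | h0
    · simp [Q, colorMinus, colorPlus, hzl, hzl.not_gt, h0, h0.not_gt, hA.weightL_of_nonpos h0.le]
    · have e := hA.Qp_eq_smul hz
      simp only [Q, colorMinus, colorPlus, hzl, hzl.not_gt, h0, h0.not_gt, if_true, if_false,
        zero_smul, one_smul, zero_add, add_zero, weightL, max_eq_left h0.le]
      exact e
  · rcases lt_or_gt_of_ne h3 with h0 | h0
    · have e := hA.Qm_eq_smul hz
      simp only [Q, colorMinus, colorPlus, hzl, hzl.not_gt, h0, h0.not_gt, if_true, if_false,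
        zero_smul, one_smul, zero_add, add_zero, weightR, min_eq_left h0.le]
      exact e
    · simp [Q, colorMinus, colorPlus, hzl, hzl.not_gt, h0, h0.not_gt, hA.weightR_of_nonneg h0.le]

end CoefficientAssumption

/-! ### Dissipativity and range of `A_{Q_l}` in the fixed energy norm -/

variable {r : ℝ} {W : Matrix (Fin 2) (Fin 2 ⊕ Fin 2) ℝ}

theorem mem_phOperator_domain (hW : BoundaryAssumption r W) {l : S.Position}
    {x : S.EnergySpace 0} :
    x ∈ (S.phOperator r W l).domain ↔ S.mulQ l (S.toX 0 x) ∈ (Jbc W l).domain := by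
  rw [mem_Jbc_domain]
  change _ ∧ _ = r * _ ∧ _ ↔ _
  rw [hW.r_eq_zero, zero_mul]
  exact Iff.rfl

theorem phOperator_apply {l : S.Position} (x : (S.phOperator r W l).domain) :
    S.phOperator r W l x =
      (S.toX 0).symm (S.J l ⟨S.mulQ l (S.toX 0 (x : S.EnergySpace 0)), x.2.1⟩) := rfl

theorem exists_isQuasiDissipative (hA : S.CoefficientAssumption) (hW : BoundaryAssumption r W) :
    ∃ ω : ℝ, 0 < ω ∧ ∀ l : S.Position, IsQuasiDissipative (S.phOperator r W l) ω := by
  obtain ⟨K, hL, hR⟩ := hA.exists_lipschitz_weights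
  have hm := S.m_pos
  -- With `u` the state in `X`, the balance gives `½ · (K/2) ‖Q_l u‖² ≤ K M² ‖u‖²`, using `‖Q_l u‖ ≤
  -- 2 M ‖u‖`, and `(m/2) ‖u‖²` is at most the squared energy norm. The summand 1 keeps the constant
  -- positive if `K = 0`.
  refine ⟨2 * K * S.M ^ 2 / S.m + 1, by positivity, fun l x => ?_⟩
  obtain ⟨h1, h2, h3⟩ := mem_Jbc_domain.1 ((mem_phOperator_domain hW).1 x.2)
  set u := S.toX 0 (x : S.EnergySpace 0)
  have h := inner_J_le h1 h2 (hL.mono (Icc_subset_Icc_right l.2.2.le))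
    (hR.mono (Icc_subset_Icc_left l.2.1.le)) (hA.weightL_of_nonpos S.a_neg.le)
    (hA.weightR_of_nonneg S.b_pos.le) (S.mulQ 0 u) (hA.mulQ_zero_eq l u)
  have h4 := boundaryPower_nonpos hW h3
  have h5 := S.le_energy_norm_sq 0 (x : S.EnergySpace 0)
  change S.m / 2 * ‖u‖ ^ 2 ≤ _ at h5
  have h6 := pow_le_pow_left₀ (norm_nonneg _) (S.norm_mulQ_le l u) 2
  rw [mul_pow] at h6
  have h7 : inner ℝ (S.phOperator r W l x) (x : S.EnergySpace 0) =
      1 / 2 * inner ℝ (S.J l ⟨S.mulQ l u, h1⟩) (S.mulQ 0 u) := by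
    rw [phOperator_apply, energy_inner_def, LinearEquiv.apply_symm_apply, inner_mulQ_comm,
      real_inner_comm]
  have hK := K.coe_nonneg
  have h8 : (K : ℝ) / 2 * ‖S.mulQ l u‖ ^ 2 ≤ K / 2 * ((2 * S.M) ^ 2 * ‖u‖ ^ 2) :=
    mul_le_mul_of_nonneg_left h6 (by positivity)
  have h9 : (K : ℝ) * S.M ^ 2 * ‖u‖ ^ 2 ≤ 2 * K * S.M ^ 2 / S.m * ‖(x : S.EnergySpace 0)‖ ^ 2 := by
    calc (K : ℝ) * S.M ^ 2 * ‖u‖ ^ 2 = 2 * K * S.M ^ 2 / S.m * (S.m / 2 * ‖u‖ ^ 2) := by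
          field_simp
      _ ≤ _ := mul_le_mul_of_nonneg_left h5 (by positivity)
  rw [h7, add_mul, one_mul]
  nlinarith [sq_nonneg ‖(x : S.EnergySpace 0)‖]

/-- Surjectivity does not depend on the choice of norm, so it is proved in plain `L²`, where the
restricted `J_l` is dissipative and `Q_l` is coercive with constant `m`. This reaches every `lam >
0`, hence every `lam > ω`. -/
theorem hasFullRange_phOperator (hW : BoundaryAssumption r W) (l : S.Position) {ω : ℝ}
    (hω : 0 ≤ ω) : HasFullRange (S.phOperator r W l) ω := by
  intro lam hlam y
  obtain ⟨u, h, e⟩ := exists_sub_comp_coercive_eq (isQuasiDissipative_Jbc hW)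
    (hasFullRange_Jbc (l := l) hW) (T := S.mulQCLM l) S.m_pos (fun x => S.le_inner_mulQ l x)
    (hω.trans_lt hlam) (S.toX 0 y)
  have hx : (S.toX 0).symm u ∈ (S.phOperator r W l).domain := by
    rw [mem_phOperator_domain hW, LinearEquiv.apply_symm_apply]
    exact h
  refine ⟨⟨(S.toX 0).symm u, hx⟩, (S.toX 0).injective ?_⟩
  rw [← e, map_sub, map_smul, LinearEquiv.apply_symm_apply, phOperator_apply,
    LinearEquiv.apply_symm_apply]
  rfl

end InterfaceSystem

/-! ### The family `A(t)`: common growth bound, generation and Kato-stability -/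

theorem mainTheorem2 (S : InterfaceSystem) (τ : ℝ) (hτ : 0 < τ) (l : ℝ → ℝ)
    (hlC : ContDiffOn ℝ 1 l (Set.Icc 0 τ))
    (hl : ∀ t ∈ Set.Icc 0 τ, l t ∈ Set.Ioo S.a S.b)
    (r : ℝ) (W : Matrix (Fin 2) (Fin 2 ⊕ Fin 2) ℝ)
    (hA1 : S.CoefficientAssumption) (hA2 : BoundaryAssumption r W)
    (A : Set.Icc (0 : ℝ) τ → S.EnergySpace 0 →ₗ.[ℝ] S.EnergySpace 0)
    (hA : ∀ t, A t = S.phOperator r W ⟨l t, hl t t.2⟩) :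
    (∃ ω : ℝ, 0 < ω ∧ ∀ t, ∀ x : (A t).domain,
      inner ℝ (A t x) (x : S.EnergySpace 0) ≤ ω * ‖(x : S.EnergySpace 0)‖ ^ 2) ∧
    ∀ ω : ℝ, 0 < ω →
      (∀ t, ∀ x : (A t).domain,
        inner ℝ (A t x) (x : S.EnergySpace 0) ≤ ω * ‖(x : S.EnergySpace 0)‖ ^ 2) →
      (∀ t, Evolution.GeneratesQuasiContractive (A t) ω) ∧
        Evolution.IsKatoStableWith A 1 ω := by
  constructor
  · obtain ⟨ω, hω, h⟩ := InterfaceSystem.exists_isQuasiDissipative hA1 hA2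
    refine ⟨ω, hω, fun t => ?_⟩
    rw [hA t]
    exact h _
  · intro ω hω hdis
    have hr : ∀ t, Evolution.HasFullRange (A t) ω := fun t => by
      rw [hA t]
      exact InterfaceSystem.hasFullRange_phOperator hA2 _ hω.le
    exact ⟨fun t => Evolution.generatesQuasiContractive (hdis t) (hr t),
      Evolution.isKatoStableWith hdis hr⟩
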